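/- **Programs.** A concurrent program $\mathcal C$ consists of threads $T_1,\dots,T_n$, each a statement of a while language with assignment, $x:=\mathsf{havoc}()$, conditionals, loops, $x:=\mathsf{input}(t)$, $\mathsf{output}(t,e)$, skip, $\mathsf{lock}/\mathsf{unlock}(m)$, $\mathsf{signal}/\mathsf{await}/\mathsf{reset}(c)$ and $\mathsf{yield}$. Variables are integer valued, and within a thread every statement has its own location label. Steps of a thread are atomic. Under the non-preemptive scheduler the current thread runs until it has finished, yields, meets a lock held by another thread, or awaits a condition variable that is not set; the preemptive scheduler may switch threads at any point. Initially all locks are free, and the other variables have a fixed initial valuation, the same for all programs considered. Executing havoc, input or output emits $(\mathit{tid},\mathsf{havoc},k,x)$, $(\mathit{tid},\mathsf{input},k,t)$ or $(\mathit{tid},\mathsf{output},k,t)$, where $k$ is the value chosen (a natural number), read (a natural number) or written. An observation sequence is the sequence of symbols emitted by an execution from the initial state to a state in which all threads have finished; $[\![\mathcal C]\!]^{P}$ and $[\![\mathcal C]\!]^{NP}$ are the sets of preemptive and non-preemptive observation sequences. Two of them are equivalent if their subsequences of input and output symbols are equal and, for each thread, their subsequences of havoc symbols of that thread are equal. $\mathcal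 C'$ is preemption-safe w.r.t. $\mathcal C$ if every sequence in $[\![\mathcal C']\!]^{P}$ has an equivalent one in $[\![\mathcal C]\!]^{NP}$. **Abstraction.** The abstract semantics ignores the values of the program variables, keeps locks and condition variables, takes branches nondeterministically, and emits symbols $(\mathit{tid},a,v,l)$: a read for each variable read in evaluating an expression, in order; a write for each variable written; a write to a special location $\mathtt{dev}$ for each input (before the write of the variable) or output; and $\mathsf{exit},\mathsf{loop},\mathsf{then},\mathsf{else}$ (with no variable) for branching choices. Two symbols are independent if they belong to different threads and either have different $v$ or are both not writes. $\mathcal A^{P}(\mathcal C)$ and $\mathcal A^{NP}(\mathcal C)$ are the automata, built from the abstract program states, of the abstract preemptive and non-preemptive observation sequences. **Inclusion check.** For an automaton $B$ and a bound $k$, the automaton $B_{k}$ has states $(s,\eta_1,\eta_2)$ with words $\eta_1,\eta_2$ of length at most $k$; it starts in $(s,\emptyset,\emptyset)$ with $s$ initial and accepts in $(s,\emptyset,\emptyset)$ with $s$ final. On $\alpha$ it chooses a transition $s\xrightarrow{\beta}s'$ of $B$; then $\alpha$ is either appended to $\eta_2$, if it does not occur in $\eta_1$ and is independent of all of $\eta_1$,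 or cancelled against an occurrence in $\eta_1$ such that $\alpha$ is independent of everything before it; then $\beta$ is treated in the same way with the roles of $\eta_1$ and the updated $\eta_2$ exchanged. The antichain algorithm for $A$ and $B_k$ keeps a frontier and an antichain of pairs $(s_A,S)$, with $s_A$ a state of $A$ and $S$ a set of states of $B_k$, ordered by $(s_A,S)\sqsubseteq(s_A,S')$ iff $S\subseteq S'$. It starts from the initial states of $A$, paired with the set of initial states of $B_k$. It repeatedly removes a pair from the frontier; it reports a counterexample word if $s_A$ is final and $S$ has no final state; otherwise it handles each successor, dropping it if some element of the antichain is $\sqsubseteq$ it, and otherwise adding it to the frontier and to the antichain and deleting from the antichain the elements above it. It reports success when the frontier is empty. The check runs this algorithm for increasing bounds $k$, starting at some positive bound: it succeeds when the algorithm reports success; a reported counterexample is returned unless it is spurious, i.e. unless the algorithm without a bound succeeds for that single word, and in this case $k$ is increased by one. **Synthesis.** The procedure starts with the candidate $\mathcal C'=\mathcal C$ and repeatedly checks $\mathcal A^{P}(\mathcal C')$ against $\mathcal A^{NP}(\mathcal C)$. If the check succeeds, it outputs $\mathcal C'$. If the check returns a counterexample $cex$, the procedure considers the permutations of its events; those feasible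 for $\mathcal C$ under the non-preemptive scheduler define a specification $\Phi=\bigvee_\pi\Phi_\pi$, where $\Phi_\pi$ records the order in $\pi$ of the non-independent events; bad traces are the permutations that are feasible for $\mathcal C'$ under the preemptive scheduler and violate $\Phi$. Bad traces $\pi$ that are not covered yet are enumerated, and each $\Phi_\pi$ is generalized to an ordering constraint $\rho$ implied by $\Phi_\pi$ all of whose feasible traces are bad, until all bad traces are covered. From these constraints fixes are inferred by the following patterns, for distinct threads $t_1,t_2$: from $t_1.l_1<t_2.l_2'\wedge t_2.l_2<t_1.l_1'$, or from $t_1.l_1<t_2.l_2\wedge t_2.l_2'<t_1.l_1'$, a lock around $l_1,l_1'$ in $t_1$ and around $l_2,l_2'$ in $t_2$; from $t_1.l_1'<t_2.l_2'$, where an $\mathsf{await}(c)$ precedes $l_1'$ in $t_1$ and a $\mathsf{signal}(c)$ precedes $l_2'$ in $t_2$, the move of that signal behind $l_2'$. Inferred fixes are applied to $\mathcal C'$: a lock fix encloses, in each of the two threads, a segment of a block that contains the two locations between $\mathsf{lock}(m)$ and $\mathsf{unlock}(m)$, at fresh locations and with a lock variable $m$ not occurring in $\mathcal C$; a reorder fix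 moves the signal behind a later segment of its block. The result is the next candidate. Which constraints $\rho$, fixes, segments and exploration orders are chosen is left open. **Proposition.** For every concurrent program $\mathcal C$, every program $\mathcal C'$ that this procedure can output when run on $\mathcal C$ (whatever choices are made) is preemption-safe with respect to $\mathcal C$: every sequence in $[\![\mathcal C']\!]^{P}$ has an equivalent sequence in $[\![\mathcal C]\!]^{NP}$. -/

import Mathlib

namespace ConcW

/-! ## The concurrent while language -/

abbrev Var := ℕ
abbrev LockVar := ℕ
abbrev CondVar := ℕ
abbrev Tag := ℕ
abbrev Loc := ℕ

/-- Expressions; an operator is an arbitrary integer function of some arity. -/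
inductive Expr : Type
  | var (x : Var) : Expr
  | const (k : ℤ) : Expr
  | op (m : ℕ) (f : (Fin m → ℤ) → ℤ) (args : Fin m → Expr) : Expr

namespace Expr

/-- The value of an expression under a valuation. -/
def eval (v : Var → ℤ) : Expr → ℤ
  | var x => v x
  | const k => k
  | op _ f args => f (fun i => (args i).eval v)

/-- The variables of an expression, in the order (left to right) in which they are read. -/
def reads : Expr → List Var
  | var x => [x]
  | const _ => []
  | op _ _ args => (List.ofFn (fun i => (args i).reads)).flatten

/-- A condition holds when its value is nonzero. -/
def IsTrue (v : Var → ℤ) (e : Expr) : Prop := e.eval v ≠ 0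

end Expr

/-- Statements. Every statement except a sequential composition carries a location. -/
inductive Stmt : Type
  | skip (l : Loc) : Stmt
  | assign (l : Loc) (x : Var) (e : Expr) : Stmt
  | havoc (l : Loc) (x : Var) : Stmt
  | ite (l : Loc) (e : Expr) (s₁ s₂ : Stmt) : Stmt
  | while (l : Loc) (e : Expr) (s : Stmt) : Stmt
  | input (l : Loc) (x : Var) (t : Tag) : Stmt
  | output (l : Loc) (t : Tag) (e : Expr) : Stmt
  | lock (l : Loc) (m : LockVar) : Stmt
  | unlock (l : Loc) (m : LockVar) : Stmt
  | signal (l : Loc) (c : CondVar) : Stmt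
  | await (l : Loc) (c : CondVar) : Stmt
  | reset (l : Loc) (c : CondVar) : Stmt
  | yield (l : Loc) : Stmt
  | seq (s₁ s₂ : Stmt) : Stmt

namespace Stmt

/-- The locations of a statement, in textual order. -/
def locs : Stmt → List Loc
  | skip l => [l]
  | assign l _ _ => [l]
  | havoc l _ => [l]
  | ite l _ s₁ s₂ => l :: (s₁.locs ++ s₂.locs)
  | .while l _ s => l :: s.locs
  | input l _ _ => [l]
  | output l _ _ => [l]
  | lock l _ => [l]
  | unlock l _ => [l]
  | signal l _ => [l]
  | await l _ => [l]
  | reset l _ => [l]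
  | yield l => [l]
  | seq s₁ s₂ => s₁.locs ++ s₂.locs

/-- All labeled statements occurring in a statement. -/
def parts : Stmt → List Stmt
  | ite l e s₁ s₂ => ite l e s₁ s₂ :: (s₁.parts ++ s₂.parts)
  | .while l e s => .while l e s :: s.parts
  | seq s₁ s₂ => s₁.parts ++ s₂.parts
  | s => [s]

/-- The statements of the outermost block, in order. -/
def block : Stmt → List Stmt
  | seq s₁ s₂ => s₁.block ++ s₂.block
  | s => [s]

/-- The thread has finished. -/
def IsSkip : Stmt → Prop
  | skip _ => True
  | _ => False

end Stmt

/-- A concurrent program with `n` threads. -/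
abbrev Program (n : ℕ) := Fin n → Stmt

/-- In each thread every statement has its own location. -/
def Program.UniqueLocs {n : ℕ} (C : Program n) : Prop := ∀ i, (C i).locs.Nodup

/-! ## Semantics of threads and of programs -/

/-- What the threads share: the data part `D` of the valuation, the holder of each lock
(`none` if free), and the values of the condition variables. -/
structure Store (D : Type) (n : ℕ) where
  data : D
  lock : LockVar → Option (Fin n)
  cond : CondVar → Bool

/-- Program states; `ctid` is the current thread, `none` before the first scheduling. -/
structure State (D : Type) (n : ℕ) where
  store : Store D n
  ctid : Option (Fin n)
  prog : Program n

/-- A single-thread semantics: `R i d s α d' s'` says that thread `i` executes one step of `s`,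
changes the data from `d` to `d'`, leaves `s'` to be executed and emits the word `α` of
observable symbols (the empty word is `ε`). -/
abbrev ThreadSem (D O : Type) (n : ℕ) := Fin n → D → Stmt → List O → D → Stmt → Prop

/-- Steps of the current thread `i`. The Boolean is `true` iff the step is one that hands
control to an arbitrarily chosen thread. -/
inductive ThreadStep {D O : Type} {n : ℕ} (R : ThreadSem D O n) (i : Fin n) :
    Store D n → Stmt → List O → Bool → Store D n → Stmt → Prop
  | sequential (σ : Store D n) (s s' : Stmt) (α : List O) (d' : D)
      (h : R i σ.data s α d' s') : ThreadStep R i σ s α false { σ with data := d' } s'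
  | lockYield (σ : Store D n) (l : Loc) (m : LockVar)
      (h : σ.lock m ≠ none ∧ σ.lock m ≠ some i) :
      ThreadStep R i σ (.lock l m) [] true σ (.lock l m)
  | lock (σ : Store D n) (l : Loc) (m : LockVar) (h : σ.lock m = none ∨ σ.lock m = some i) :
      ThreadStep R i σ (.lock l m) [] false
        { σ with lock := Function.update σ.lock m (some i) } (.skip l)
  | unlock (σ : Store D n) (l : Loc) (m : LockVar) (h : σ.lock m = some i) :
      ThreadStep R i σ (.unlock l m) [] false
        { σ with lock := Function.update σ.lock m none } (.skip l)
  | awaitYield (σ : Store D n) (l : Loc) (c : CondVar) (h : σ.cond c = false) :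
      ThreadStep R i σ (.await l c) [] true σ (.await l c)
  | await (σ : Store D n) (l : Loc) (c : CondVar) (h : σ.cond c = true) :
      ThreadStep R i σ (.await l c) [] false σ (.skip l)
  | signal (σ : Store D n) (l : Loc) (c : CondVar) :
      ThreadStep R i σ (.signal l c) [] false
        { σ with cond := Function.update σ.cond c true } (.skip l)
  | reset (σ : Store D n) (l : Loc) (c : CondVar) :
      ThreadStep R i σ (.reset l c) [] false
        { σ with cond := Function.update σ.cond c false } (.skip l)
  | yield (σ : Store D n) (l : Loc) :
      ThreadStep R i σ (.yield l) [] true σ (.skip l)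
  | seq (σ σ' : Store D n) (s₁ s₁' s₂ : Stmt) (α : List O) (b : Bool)
      (h : ThreadStep R i σ s₁ α b σ' s₁') :
      ThreadStep R i σ (.seq s₁ s₂) α b σ' (.seq s₁' s₂)

/-- The two schedulers. -/
inductive Mode : Type
  | nonpreemptive : Mode
  | preemptive : Mode

/-- Steps of a program under a scheduler. -/
inductive Step {D O : Type} {n : ℕ} (R : ThreadSem D O n) (μ : Mode) :
    State D n → List O → State D n → Prop
  | scheduleStart (σ : Store D n) (P : Program n) (j : Fin n) :
      Step R μ ⟨σ, none, P⟩ [] ⟨σ, some j, P⟩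
  | run (σ σ' : Store D n) (P : Program n) (i : Fin n) (s' : Stmt) (α : List O)
      (h : ThreadStep R i σ (P i) α false σ' s') :
      Step R μ ⟨σ, some i, P⟩ α ⟨σ', some i, Function.update P i s'⟩
  | switch (σ σ' : Store D n) (P : Program n) (i j : Fin n) (s' : Stmt) (α : List O)
      (h : ThreadStep R i σ (P i) α true σ' s') :
      Step R μ ⟨σ, some i, P⟩ α ⟨σ', some j, Function.update P i s'⟩
  | descheduleSkip (σ : Store D n) (P : Program n) (i j : Fin n) (h : (P i).IsSkip) :
      Step R μ ⟨σ, some i, P⟩ [] ⟨σ, some j, P⟩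
  | deschedulePreempt (σ : Store D n) (P : Program n) (c : Option (Fin n)) (j : Fin n)
      (h : μ = .preemptive) : Step R μ ⟨σ, c, P⟩ [] ⟨σ, some j, P⟩

/-- Finite executions, with the word of observable symbols that they emit. -/
inductive Run {D O : Type} {n : ℕ} (R : ThreadSem D O n) (μ : Mode) :
    State D n → List O → State D n → Prop
  | refl (p : State D n) : Run R μ p [] p
  | head (p q r : State D n) (α w : List O) (h : Step R μ p α q) (hr : Run R μ q w r) :
      Run R μ p (α ++ w) r

/-- The initial state: all locks are free and no thread is scheduled. -/
def initState {D : Type} {n : ℕ} (d₀ : D) (c₀ : CondVar → Bool) (C : Program n) : State D n :=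
  ⟨⟨d₀, fun _ => none, c₀⟩, none, C⟩

/-- Final states: all threads have finished. -/
def State.Final {D : Type} {n : ℕ} (p : State D n) : Prop := ∀ i, (p.prog i).IsSkip

/-- The observation sequences of a program: what its terminating executions emit. -/
def obsSeqs {D O : Type} {n : ℕ} (R : ThreadSem D O n) (μ : Mode) (d₀ : D)
    (c₀ : CondVar → Bool) (C : Program n) : Set (List O) :=
  {w | ∃ p, Run R μ (initState d₀ c₀ C) w p ∧ p.Final}

/-! ## Concrete semantics and preemption-safety -/

/-- Observable symbols of the concrete semantics. -/
inductive Obs (n : ℕ) : Type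
  | havoc (i : Fin n) (k : ℤ) (x : Var) : Obs n
  | input (i : Fin n) (k : ℤ) (t : Tag) : Obs n
  | output (i : Fin n) (k : ℤ) (t : Tag) : Obs n

namespace Obs

/-- The symbol is an input or an output. -/
def isInterface {n : ℕ} : Obs n → Bool
  | havoc _ _ _ => false
  | input _ _ _ => true
  | output _ _ _ => true

/-- The symbol is a havoc of thread `i`. -/
def isHavocOf {n : ℕ} (i : Fin n) : Obs n → Bool
  | havoc j _ _ => decide (j = i)
  | input _ _ _ => false
  | output _ _ _ => false

/-- Equivalence of observation sequences. -/
def Equivalent {n : ℕ} (u w : List (Obs n)) : Prop :=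
  u.filter isInterface = w.filter isInterface ∧
    ∀ i : Fin n, u.filter (isHavocOf i) = w.filter (isHavocOf i)

end Obs

/-- Single-thread concrete semantics. -/
inductive ConcreteStep {n : ℕ} : ThreadSem (Var → ℤ) (Obs n) n
  | assign (i : Fin n) (v : Var → ℤ) (l : Loc) (x : Var) (e : Expr) :
      ConcreteStep i v (.assign l x e) [] (Function.update v x (e.eval v)) (.skip l)
  | havoc (i : Fin n) (v : Var → ℤ) (l : Loc) (x : Var) (k : ℕ) :
      ConcreteStep i v (.havoc l x) [.havoc i k x] (Function.update v x (k : ℤ)) (.skip l)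
  | while_exit (i : Fin n) (v : Var → ℤ) (l : Loc) (e : Expr) (s : Stmt) (h : ¬ e.IsTrue v) :
      ConcreteStep i v (.while l e s) [] v (.skip l)
  | while_loop (i : Fin n) (v : Var → ℤ) (l : Loc) (e : Expr) (s : Stmt) (h : e.IsTrue v) :
      ConcreteStep i v (.while l e s) [] v (.seq s (.while l e s))
  | ite_then (i : Fin n) (v : Var → ℤ) (l : Loc) (e : Expr) (s₁ s₂ : Stmt) (h : e.IsTrue v) :
      ConcreteStep i v (.ite l e s₁ s₂) [] v s₁
  | ite_else (i : Fin n) (v : Var → ℤ) (l : Loc) (e : Expr) (s₁ s₂ : Stmt) (h : ¬ e.IsTrue v) :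
      ConcreteStep i v (.ite l e s₁ s₂) [] v s₂
  | seq (i : Fin n) (v v' : Var → ℤ) (s₁ s₁' s₂ : Stmt) (α : List (Obs n))
      (h : ConcreteStep i v s₁ α v' s₁') :
      ConcreteStep i v (.seq s₁ s₂) α v' (.seq s₁' s₂)
  | skip (i : Fin n) (v : Var → ℤ) (l : Loc) (s : Stmt) :
      ConcreteStep i v (.seq (.skip l) s) [] v s
  | input (i : Fin n) (v : Var → ℤ) (l : Loc) (x : Var) (t : Tag) (k : ℕ) :
      ConcreteStep i v (.input l x t) [.input i k t] (Function.update v x (k : ℤ)) (.skip l)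
  | output (i : Fin n) (v : Var → ℤ) (l : Loc) (t : Tag) (e : Expr) :
      ConcreteStep i v (.output l t e) [.output i (e.eval v) t] v (.skip l)

/-- `C'` is preemption-safe with respect to `C`, from the initial valuation `v₀`, `c₀`: every
preemptive observation sequence of `C'` has an equivalent non-preemptive one of `C`. -/
def PreemptionSafe {n : ℕ} (v₀ : Var → ℤ) (c₀ : CondVar → Bool) (C' C : Program n) : Prop :=
  ∀ w ∈ obsSeqs ConcreteStep .preemptive v₀ c₀ C',
    ∃ u ∈ obsSeqs ConcreteStep .nonpreemptive v₀ c₀ C, Obs.Equivalent w u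

/-! ## Abstract semantics and its automata -/

/-- Memory locations of the abstraction: program variables and the external interface. -/
inductive Mem : Type
  | dev : Mem
  | var (x : Var) : Mem

/-- Kinds of abstract observables. -/
inductive Act : Type
  | read : Act
  | write : Act
  | exit : Act
  | loop : Act
  | thenBranch : Act
  | elseBranch : Act

/-- Abstract observable symbols; `mem = none` for branching choices. -/
structure AbsSym (n : ℕ) where
  tid : Fin n
  act : Act
  mem : Option Mem
  loc : Loc

/-- The reads made when `e` is evaluated at location `l`. -/
def readSyms {n : ℕ} (i : Fin n) (e : Expr) (l : Loc) : List (AbsSym n) :=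
  e.reads.map (fun x => ⟨i, .read, some (.var x), l⟩)

/-- Single-thread abstract semantics: values are ignored. -/
inductive AbstractStep {n : ℕ} : ThreadSem Unit (AbsSym n) n
  | assign (i : Fin n) (l : Loc) (x : Var) (e : Expr) :
      AbstractStep i () (.assign l x e) (readSyms i e l ++ [⟨i, .write, some (.var x), l⟩])
        () (.skip l)
  | havoc (i : Fin n) (l : Loc) (x : Var) :
      AbstractStep i () (.havoc l x) [⟨i, .write, some (.var x), l⟩] () (.skip l)
  | while_exit (i : Fin n) (l : Loc) (e : Expr) (s : Stmt) :
      AbstractStep i () (.while l e s) (readSyms i e l ++ [⟨i, .exit, none, l⟩]) () (.skip l)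
  | while_loop (i : Fin n) (l : Loc) (e : Expr) (s : Stmt) :
      AbstractStep i () (.while l e s) (readSyms i e l ++ [⟨i, .loop, none, l⟩])
        () (.seq s (.while l e s))
  | ite_then (i : Fin n) (l : Loc) (e : Expr) (s₁ s₂ : Stmt) :
      AbstractStep i () (.ite l e s₁ s₂) (readSyms i e l ++ [⟨i, .thenBranch, none, l⟩]) () s₁
  | ite_else (i : Fin n) (l : Loc) (e : Expr) (s₁ s₂ : Stmt) :
      AbstractStep i () (.ite l e s₁ s₂) (readSyms i e l ++ [⟨i, .elseBranch, none, l⟩]) () s₂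
  | seq (i : Fin n) (s₁ s₁' s₂ : Stmt) (α : List (AbsSym n))
      (h : AbstractStep i () s₁ α () s₁') :
      AbstractStep i () (.seq s₁ s₂) α () (.seq s₁' s₂)
  | skip (i : Fin n) (l : Loc) (s : Stmt) :
      AbstractStep i () (.seq (.skip l) s) [] () s
  | input (i : Fin n) (l : Loc) (x : Var) (t : Tag) :
      AbstractStep i () (.input l x t)
        [⟨i, .write, some .dev, l⟩, ⟨i, .write, some (.var x), l⟩] () (.skip l)
  | output (i : Fin n) (l : Loc) (t : Tag) (e : Expr) :
      AbstractStep i () (.output l t e) (readSyms i e l ++ [⟨i, .write, some .dev, l⟩])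
        () (.skip l)

/-- States of the automaton of a program: an abstract program state, and the symbols of the
last step that are still to be emitted. -/
abbrev AutState (n : ℕ) := State Unit n × List (AbsSym n)

/-- The automaton of the abstract observation sequences of a program, with `ε`-transitions. -/
def absEpsAutomaton {n : ℕ} (μ : Mode) (c₀ : CondVar → Bool) (C : Program n) :
    εNFA (AbsSym n) (AutState n) where
  step q a := match a with
    | none => {q' | q.2 = [] ∧ Step AbstractStep μ q.1 q'.2 q'.1}
    | some a => {q' | q.2 = a :: q'.2 ∧ q'.1 = q.1}
  start := {(initState () c₀ C, [])}
  accept := {q | q.2 = [] ∧ q.1.Final}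

/-- The automaton of the abstract observation sequences of a program. -/
def absAutomaton {n : ℕ} (μ : Mode) (c₀ : CondVar → Bool) (C : Program n) :
    NFA (AbsSym n) (AutState n) :=
  (absEpsAutomaton μ c₀ C).toNFA

/-- The independence relation on abstract observables. -/
def Indep {n : ℕ} (a b : AbsSym n) : Prop :=
  a.tid ≠ b.tid ∧ (a.mem ≠ b.mem ∨ (a.act ≠ .write ∧ b.act ≠ .write))

/-! ## Bounded language inclusion modulo an independence relation -/

/-- One half of a transition of the bounded closure automaton: the symbol `a` meets the queue
`η` of symbols emitted earlier by the other side. It is either independent of all of `η`, and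
then joins its own queue `ζ`, or it cancels its occurrence in `η`, provided that it is
independent of everything in front of that. -/
def Meets {α : Type} (I : α → α → Prop) (a : α) (η ζ η' ζ' : List α) : Prop :=
  (a ∉ η ∧ (∀ b ∈ η, I a b) ∧ η' = η ∧ ζ' = ζ ++ [a]) ∨
    (∃ x y, η = x ++ a :: y ∧ (∀ b ∈ x, I a b) ∧ η' = x ++ y ∧ ζ' = ζ)

/-- The automaton that reads words of `B` up to commutations of independent symbols, with
queues of length at most `k`. -/
def boundedClosure {α σ : Type} (I : α → α → Prop) (k : ℕ∞) (B : NFA α σ) :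
    NFA α (σ × List α × List α) where
  step q a := {q' | ∃ (b : α) (μ₁ μ₂ : List α), q'.1 ∈ B.step q.1 b ∧
    Meets I a q.2.1 q.2.2 μ₁ μ₂ ∧ Meets I b μ₂ μ₁ q'.2.2 q'.2.1 ∧
    (q'.2.1.length : ℕ∞) ≤ k ∧ (q'.2.2.length : ℕ∞) ≤ k}
  start := {q | q.1 ∈ B.start ∧ q.2 = ([], [])}
  accept := {q | q.1 ∈ B.accept ∧ q.2 = ([], [])}

/-- Configurations of the antichain algorithm. Frontier elements carry the word that led to
them; `todo` holds the computed successors that have not been handled yet. -/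
structure AntichainConfig (α σ τ : Type) where
  frontier : Set (σ × Set τ × List α)
  antichain : Set (σ × Set τ)
  todo : Set (σ × Set τ × List α)

/-- The ordering of tuples. -/
def Below {σ τ : Type} (p q : σ × Set τ) : Prop := p.1 = q.1 ∧ p.2 ⊆ q.2

/-- A tuple that refutes the inclusion. -/
def Refutes {α σ τ : Type} (A : NFA α σ) (B : NFA α τ) (s : σ) (S : Set τ) : Prop :=
  s ∈ A.accept ∧ S ∩ B.accept = ∅

/-- The start of the antichain algorithm. -/
def antichainInit {α σ τ : Type} (A : NFA α σ) (B : NFA α τ) : AntichainConfig α σ τ where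
  frontier := {x | x.1 ∈ A.start ∧ x.2 = (B.start, [])}
  antichain := {p | p.1 ∈ A.start ∧ p.2 = B.start}
  todo := ∅

/-- Steps of the antichain algorithm for the inclusion of the language of `A` in that of `B`. -/
inductive AntichainStep {α σ τ : Type} (A : NFA α σ) (B : NFA α τ) :
    AntichainConfig α σ τ → AntichainConfig α σ τ → Prop
  | explore (F : Set (σ × Set τ × List α)) (X : Set (σ × Set τ)) (s : σ) (S : Set τ)
      (w : List α) (hmem : (s, S, w) ∈ F) (hok : ¬ Refutes A B s S) :
      AntichainStep A B ⟨F, X, ∅⟩ ⟨F \ {(s, S, w)}, X,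
        {x | ∃ a, x.1 ∈ A.step s a ∧ x.2.1 = B.stepSet S a ∧ x.2.2 = w ++ [a]}⟩
  | prune (F T : Set (σ × Set τ × List α)) (X : Set (σ × Set τ)) (s : σ) (S : Set τ)
      (w : List α) (hmem : (s, S, w) ∈ T) (hbelow : ∃ p ∈ X, Below p (s, S)) :
      AntichainStep A B ⟨F, X, T⟩ ⟨F, X, T \ {(s, S, w)}⟩
  | add (F T : Set (σ × Set τ × List α)) (X : Set (σ × Set τ)) (s : σ) (S : Set τ)
      (w : List α) (hmem : (s, S, w) ∈ T) (hbelow : ¬ ∃ p ∈ X, Below p (s, S)) :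
      AntichainStep A B ⟨F, X, T⟩
        ⟨F ∪ {(s, S, w)}, (X \ {p | Below (s, S) p}) ∪ {(s, S)}, T \ {(s, S, w)}⟩

/-- The answers of the antichain algorithm: `none` for success, `some w` for the
counterexample `w`. -/
inductive AntichainAnswer {α σ τ : Type} (A : NFA α σ) (B : NFA α τ) : Option (List α) → Prop
  | success (X : Set (σ × Set τ))
      (h : Relation.ReflTransGen (AntichainStep A B) (antichainInit A B) ⟨∅, X, ∅⟩) :
      AntichainAnswer A B none
  | failure (F : Set (σ × Set τ × List α)) (X : Set (σ × Set τ)) (s : σ) (S : Set τ)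
      (w : List α)
      (h : Relation.ReflTransGen (AntichainStep A B) (antichainInit A B) ⟨F, X, ∅⟩)
      (hmem : (s, S, w) ∈ F) (hbad : Refutes A B s S) :
      AntichainAnswer A B (some w)

/-- The automaton that accepts exactly the word `w`. -/
def wordAutomaton {α : Type} (w : List α) : NFA α ℕ where
  step i a := {j | j = i + 1 ∧ w[i]? = some a}
  start := {0}
  accept := {w.length}

/-- The inclusion check with increasing bounds, from the bound `k` on. A counterexample is
spurious if the check without a bound succeeds for that single word. -/
inductive CheckFrom {α σ τ : Type} (I : α → α → Prop) (A : NFA α σ) (B : NFA α τ) :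
    ℕ → Option (List α) → Prop
  | holds (k : ℕ) (h : AntichainAnswer A (boundedClosure I (k : ℕ∞) B) none) :
      CheckFrom I A B k none
  | genuine (k : ℕ) (w w' : List α)
      (h : AntichainAnswer A (boundedClosure I (k : ℕ∞) B) (some w))
      (hw : AntichainAnswer (wordAutomaton w) (boundedClosure I ⊤ B) (some w')) :
      CheckFrom I A B k (some w)
  | spurious (k : ℕ) (w : List α) (r : Option (List α))
      (h : AntichainAnswer A (boundedClosure I (k : ℕ∞) B) (some w))
      (hw : AntichainAnswer (wordAutomaton w) (boundedClosure I ⊤ B) none)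
      (hr : CheckFrom I A B (k + 1) r) :
      CheckFrom I A B k r

/-- The check of a candidate `C'` against `C` under the abstract semantics, started at some
positive bound: `none` if `C'` is found preemption-safe, `some w` if `w` is a counterexample. -/
def Check {n : ℕ} (c₀ : CondVar → Bool) (C' C : Program n) (r : Option (List (AbsSym n))) :
    Prop :=
  ∃ k : ℕ, 0 < k ∧
    CheckFrom Indep (absAutomaton .preemptive c₀ C') (absAutomaton .nonpreemptive c₀ C) k r

/-! ## Counterexample generalization -/

/-- Ordering constraints over `m` events. -/
inductive OrdCon (m : ℕ) : Type
  | lt (a b : Fin m) : OrdCon m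
  | top : OrdCon m
  | and (φ ψ : OrdCon m) : OrdCon m
  | or (φ ψ : OrdCon m) : OrdCon m
  | not (φ : OrdCon m) : OrdCon m

/-- Traces over `m` events: the event at each point of time. -/
abbrev Trace (m : ℕ) := Equiv.Perm (Fin m)

/-- Event `a` is scheduled before event `b`. -/
def Trace.Before {m : ℕ} (π : Trace m) (a b : Fin m) : Prop := π.symm a < π.symm b

namespace OrdCon

/-- The trace belongs to the set represented by the constraint. -/
def Sat {m : ℕ} (π : Trace m) : OrdCon m → Prop
  | lt a b => π.Before a b
  | top => True
  | and φ ψ => φ.Sat π ∧ ψ.Sat π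
  | or φ ψ => φ.Sat π ∨ ψ.Sat π
  | not φ => ¬ φ.Sat π

/-- Finite conjunctions. -/
def conj {m : ℕ} (L : List (OrdCon m)) : OrdCon m := L.foldr and top

/-- Finite disjunctions. -/
def disj {m : ℕ} (L : List (OrdCon m)) : OrdCon m := L.foldr or (not top)

/-- The conjuncts of a constraint. -/
def conjuncts {m : ℕ} : OrdCon m → List (OrdCon m)
  | and φ ψ => φ.conjuncts ++ ψ.conjuncts
  | φ => [φ]

/-- The subexpressions of a constraint that are not below a negation. -/
def subexprs {m : ℕ} : OrdCon m → List (OrdCon m)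
  | and φ ψ => and φ ψ :: (φ.subexprs ++ ψ.subexprs)
  | or φ ψ => or φ ψ :: (φ.subexprs ++ ψ.subexprs)
  | φ => [φ]

end OrdCon

/-- The abstract observation sequence of a trace in the neighborhood of `cex`: the events are
the positions of `cex`, and the traces are the permutations of the events. -/
def traceWord {n : ℕ} (cex : List (AbsSym n)) (π : Trace cex.length) : List (AbsSym n) :=
  List.ofFn (fun t => cex.get (π t))

/-- The trace is feasible for a program under a scheduler. -/
def Feasible {n : ℕ} (μ : Mode) (c₀ : CondVar → Bool) (C : Program n) (cex : List (AbsSym n))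
    (π : Trace cex.length) : Prop :=
  traceWord cex π ∈ (absAutomaton μ c₀ C).accepts

open Classical in
/-- The order that a trace imposes on events that are not independent. -/
noncomputable def traceCon {n : ℕ} (cex : List (AbsSym n)) (π : Trace cex.length) :
    OrdCon cex.length :=
  OrdCon.conj ((((Finset.univ : Finset (Fin cex.length × Fin cex.length)).filter
    (fun p => ¬ Indep (cex.get p.1) (cex.get p.2) ∧ π.Before p.1 p.2)).toList).map
      (fun p => OrdCon.lt p.1 p.2))

open Classical in
/-- The correctness specification of the neighborhood: its traces that are feasible for the
original program under the non-preemptive scheduler. -/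
noncomputable def specCon {n : ℕ} (c₀ : CondVar → Bool) (C : Program n)
    (cex : List (AbsSym n)) : OrdCon cex.length :=
  OrdCon.disj ((((Finset.univ : Finset (Trace cex.length)).filter
    (fun π => Feasible .nonpreemptive c₀ C cex π)).toList).map (traceCon cex))

/-- The bad traces of the neighborhood. -/
def BadTrace {n : ℕ} (c₀ : CondVar → Bool) (C' C : Program n) (cex : List (AbsSym n))
    (π : Trace cex.length) : Prop :=
  Feasible .preemptive c₀ C' cex π ∧ ¬ (specCon c₀ C cex).Sat π

/-- Enumeration of bad traces that are not yet covered, each one generalized to a constraint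
that it implies and all of whose feasible traces are bad. -/
inductive Enumerates {n : ℕ} (c₀ : CondVar → Bool) (C' C : Program n) (cex : List (AbsSym n)) :
    List (OrdCon cex.length) → Prop
  | nil : Enumerates c₀ C' C cex []
  | cons (G : List (OrdCon cex.length)) (π : Trace cex.length) (ρ : OrdCon cex.length)
      (hG : Enumerates c₀ C' C cex G) (hbad : BadTrace c₀ C' C cex π)
      (hnew : ∀ φ ∈ G, ¬ φ.Sat π)
      (hgen : ∀ π', (traceCon cex π).Sat π' → ρ.Sat π')
      (hall : ∀ π', ρ.Sat π' → Feasible .preemptive c₀ C' cex π' → BadTrace c₀ C' C cex π') :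
      Enumerates c₀ C' C cex (ρ :: G)

/-- The generalized constraints `G` characterize all bad traces of the neighborhood. -/
def Generalizes {n : ℕ} (c₀ : CondVar → Bool) (C' C : Program n) (cex : List (AbsSym n))
    (G : List (OrdCon cex.length)) : Prop :=
  Enumerates c₀ C' C cex G ∧ ∀ π, BadTrace c₀ C' C cex π → ∃ ρ ∈ G, ρ.Sat π

/-! ## Inference and application of fixes -/

/-- Synchronization fixes. -/
inductive Fix (n : ℕ) : Type
  | lock (i : Fin n) (l l' : Loc) (j : Fin n) (r r' : Loc) : Fix n
  | reorder (i : Fin n) (l l' : Loc) : Fix n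

/-- The rules that infer a fix from a generalized constraint `ρ`; `C'` is the candidate. -/
inductive Infers {n : ℕ} (C' : Program n) (cex : List (AbsSym n)) (ρ : OrdCon cex.length) :
    Fix n → Prop
  | addLock (φ : OrdCon cex.length) (hφ : φ ∈ ρ.subexprs) (a a' b b' : Fin cex.length)
      (ha : (cex.get a).tid = (cex.get a').tid) (hb : (cex.get b).tid = (cex.get b').tid)
      (hab : (cex.get a).tid ≠ (cex.get b).tid)
      (h₁ : OrdCon.lt a b' ∈ φ.conjuncts) (h₂ : OrdCon.lt b a' ∈ φ.conjuncts) :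
      Infers C' cex ρ (.lock (cex.get a).tid (cex.get a).loc (cex.get a').loc
        (cex.get b).tid (cex.get b).loc (cex.get b').loc)
  | addLock2 (φ : OrdCon cex.length) (hφ : φ ∈ ρ.subexprs) (a a' b b' : Fin cex.length)
      (ha : (cex.get a).tid = (cex.get a').tid) (hb : (cex.get b).tid = (cex.get b').tid)
      (hab : (cex.get a).tid ≠ (cex.get b).tid)
      (h₁ : OrdCon.lt a b ∈ φ.conjuncts) (h₂ : OrdCon.lt b' a' ∈ φ.conjuncts) :
      Infers C' cex ρ (.lock (cex.get a).tid (cex.get a).loc (cex.get a').loc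
        (cex.get b).tid (cex.get b).loc (cex.get b').loc)
  | addReorder (φ : OrdCon cex.length) (hφ : φ ∈ ρ.subexprs) (a' b' : Fin cex.length)
      (hab : (cex.get a').tid ≠ (cex.get b').tid)
      (h₁ : OrdCon.lt a' b' ∈ φ.conjuncts) (l₁ l₂ : Loc) (c : CondVar)
      (hl₁ : [l₁, (cex.get a').loc].Sublist (C' (cex.get a').tid).locs)
      (hl₂ : [l₂, (cex.get b').loc].Sublist (C' (cex.get b').tid).locs)
      (hc₁ : Stmt.await l₁ c ∈ (C' (cex.get a').tid).parts)
      (hc₂ : Stmt.signal l₂ c ∈ (C' (cex.get b').tid).parts) :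
      Infers C' cex ρ (.reorder (cex.get b').tid l₂ (cex.get b').loc)

/-- Rewriting of one block of a statement, at any depth. -/
inductive RewriteBlock (T : List Stmt → List Stmt → Prop) : Stmt → Stmt → Prop
  | here (s s' : Stmt) (h : T s.block s'.block) : RewriteBlock T s s'
  | ite_then (l : Loc) (e : Expr) (s₁ s₁' s₂ : Stmt) (h : RewriteBlock T s₁ s₁') :
      RewriteBlock T (.ite l e s₁ s₂) (.ite l e s₁' s₂)
  | ite_else (l : Loc) (e : Expr) (s₁ s₂ s₂' : Stmt) (h : RewriteBlock T s₂ s₂') :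
      RewriteBlock T (.ite l e s₁ s₂) (.ite l e s₁ s₂')
  | while_body (l : Loc) (e : Expr) (s s' : Stmt) (h : RewriteBlock T s s') :
      RewriteBlock T (.while l e s) (.while l e s')
  | seq_left (s₁ s₁' s₂ : Stmt) (h : RewriteBlock T s₁ s₁') :
      RewriteBlock T (.seq s₁ s₂) (.seq s₁' s₂)
  | seq_right (s₁ s₂ s₂' : Stmt) (h : RewriteBlock T s₂ s₂') :
      RewriteBlock T (.seq s₁ s₂) (.seq s₁ s₂')

/-- Put a segment of a block that contains the locations `l` and `l'` between
`a: lock(m)` and `b: unlock(m)`. -/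
def LockSegment (m : LockVar) (a b l l' : Loc) (L L' : List Stmt) : Prop :=
  ∃ pre mid post : List Stmt, L = pre ++ mid ++ post ∧
    (∃ s ∈ mid, l ∈ s.locs) ∧ (∃ s ∈ mid, l' ∈ s.locs) ∧
    L' = pre ++ [Stmt.lock a m] ++ mid ++ [Stmt.unlock b m] ++ post

/-- Move the signal at `l` behind a later segment of its block that contains `l'`. -/
def MoveSignal (l l' : Loc) (L L' : List Stmt) : Prop :=
  ∃ (c : CondVar) (pre mid post : List Stmt), L = pre ++ [Stmt.signal l c] ++ mid ++ post ∧
    (∃ s ∈ mid, l' ∈ s.locs) ∧ L' = pre ++ mid ++ [Stmt.signal l c] ++ post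

/-- Insertion of `lock(m)` and `unlock(m)`, at fresh locations, around `l` and `l'` in
thread `i`. -/
def InsertLock {n : ℕ} (m : LockVar) (i : Fin n) (l l' : Loc) (P P' : Program n) : Prop :=
  ∃ (a b : Loc) (s' : Stmt), a ≠ b ∧ a ∉ (P i).locs ∧ b ∉ (P i).locs ∧
    RewriteBlock (LockSegment m a b l l') (P i) s' ∧ P' = Function.update P i s'

/-- The lock variable occurs in the program. -/
def UsesLock {n : ℕ} (P : Program n) (m : LockVar) : Prop :=
  ∃ i l, Stmt.lock l m ∈ (P i).parts ∨ Stmt.unlock l m ∈ (P i).parts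

/-- Application of a fix to the program `P`; the lock variable that is used for a lock fix does
not occur in the original program `C`. -/
inductive ApplyFix {n : ℕ} (C : Program n) : Fix n → Program n → Program n → Prop
  | lock (i : Fin n) (l l' : Loc) (j : Fin n) (r r' : Loc) (m : LockVar) (P P₁ P₂ : Program n)
      (hm : ¬ UsesLock C m) (h₁ : InsertLock m i l l' P P₁) (h₂ : InsertLock m j r r' P₁ P₂) :
      ApplyFix C (.lock i l l' j r r') P P₂
  | reorder (i : Fin n) (l l' : Loc) (P : Program n) (s' : Stmt)
      (h : RewriteBlock (MoveSignal l l') (P i) s') :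
      ApplyFix C (.reorder i l l') P (Function.update P i s')

/-- Application of several fixes, one after the other. -/
inductive ApplyFixes {n : ℕ} (C : Program n) : List (Fix n) → Program n → Program n → Prop
  | nil (P : Program n) : ApplyFixes C [] P P
  | cons (f : Fix n) (fs : List (Fix n)) (P P' P'' : Program n)
      (h : ApplyFix C f P P') (hs : ApplyFixes C fs P' P'') : ApplyFixes C (f :: fs) P P''

/-! ## The synthesis procedure -/

/-- The candidates that the synthesis procedure can generate from the original program `C`. -/
inductive Candidate {n : ℕ} (c₀ : CondVar → Bool) (C : Program n) : Program n → Prop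
  | original : Candidate c₀ C C
  | refine (C' C'' : Program n) (cex : List (AbsSym n)) (G : List (OrdCon cex.length))
      (fs : List (Fix n)) (hC' : Candidate c₀ C C') (hcex : Check c₀ C' C (some cex))
      (hG : Generalizes c₀ C' C cex G) (hfs : ∀ f ∈ fs, ∃ ρ ∈ G, Infers C' cex ρ f)
      (happ : ApplyFixes C fs C' C'') : Candidate c₀ C C''

/-- The synthesis procedure, run on `C`, can output `C'`: it reaches the candidate `C'`, and the
check of `C'` against `C` succeeds. -/
def Synthesizes {n : ℕ} (c₀ : CondVar → Bool) (C C' : Program n) : Prop :=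
  Candidate c₀ C C' ∧ Check c₀ C' C none

end ConcW

/-! Safety rests on two facts about the output `C'`: its last check succeeded, and its data
statements come from `C`. How counterexamples and fixes were chosen does not matter beyond the
second fact.

A successful run of the antichain algorithm proves a language inclusion
(`AntichainAnswer.accepts_subset`), and the bounded closure automaton reads only words that can be
rewritten into words of `B` by exchanging adjacent independent symbols
(`exists_swaps_of_mem_boundedClosure`). So each abstract preemptive word of `C'` commutes into an
abstract non-preemptive word of `C` (`Check.exists_swaps`). It remains to transport this to concrete
executions, whose values the abstraction has forgotten.

For that, every abstract symbol is annotated with the value read or written and with the concrete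
symbols it carries. A concrete execution of `C'` yields such an annotated word (`Run.annotate`). The
commutations lift to it (`Swaps.exists_annotated`): exchanging independent symbols keeps every read
supplied by the same value, the final valuation, the subword of each thread, and the equivalence
class of the concrete observations.

Conversely, the abstract execution of `C` along the commuted word can be executed concretely with
the annotated values (`Run.concretize`). The difficulty is to see that the annotations describe what
the statements of `C` compute. Fixes add no headers of data statements (`Candidate.headers_subset`),
and in `C` a location determines the header within a thread. Hence the symbols emitted by a step of
`C` form exactly one block recorded from `C'` for the same header, and the values written, the
branch taken and the symbols emitted are those that the step produces from the values read. -/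

namespace ConcW

/-! ## The antichain algorithm -/

section Antichain

variable {α σ τ : Type}

theorem Below.trans {p q r : σ × Set τ} (h : Below p q) (h' : Below q r) : Below p r :=
  ⟨h.1.trans h'.1, h.2.trans h'.2⟩

/-- Some element of `X` is below `p`. -/
def CoveredBy (X : Set (σ × Set τ)) (p : σ × Set τ) : Prop := ∃ q ∈ X, Below q p

/-- The invariant of the antichain algorithm: the antichain covers the initial tuples, and each of
its elements is in the frontier or has been explored. -/
def AntichainInvariant (A : NFA α σ) (B : NFA α τ) (c : AntichainConfig α σ τ) : Prop :=
  (∀ s ∈ A.start, CoveredBy c.antichain (s, B.start)) ∧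
    ∀ s S, (s, S) ∈ c.antichain → (∃ w, (s, S, w) ∈ c.frontier) ∨
      (¬ Refutes A B s S ∧ ∀ a, ∀ s' ∈ A.step s a,
        (∃ w, (s', B.stepSet S a, w) ∈ c.todo) ∨
          CoveredBy c.antichain (s', B.stepSet S a))

theorem AntichainInvariant.init (A : NFA α σ) (B : NFA α τ) :
    AntichainInvariant A B (antichainInit A B) := by
  refine ⟨fun s hs => ⟨(s, B.start), ⟨hs, rfl⟩, rfl, subset_rfl⟩, ?_⟩
  rintro s S ⟨hs, hS⟩
  exact .inl ⟨[], hs, by simp only at hS; simp [hS]⟩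

/-- A deleted element lies above the new one, which takes over its covering role by transitivity. -/
theorem CoveredBy.add {X : Set (σ × Set τ)} {p q : σ × Set τ} (h : CoveredBy X p) :
    CoveredBy ((X \ {p | Below q p}) ∪ {q}) p := by
  obtain ⟨r, hr, hrp⟩ := h
  by_cases hq : Below q r
  · exact ⟨q, .inr rfl, hq.trans hrp⟩
  · exact ⟨r, .inl ⟨hr, hq⟩, hrp⟩

/-- The invariant speaks only of pairs in the antichain, so frontier entries whose pair has been
deleted do no harm. -/
theorem AntichainInvariant.step {A : NFA α σ} {B : NFA α τ} {c c' : AntichainConfig α σ τ}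
    (hc : AntichainInvariant A B c) (h : AntichainStep A B c c') :
    AntichainInvariant A B c' := by
  obtain ⟨h₁, h₂⟩ := hc
  cases h with
  | explore F X s S w hmem hok =>
    refine ⟨h₁, fun t T ht => ?_⟩
    by_cases hts : t = s ∧ T = S
    · obtain ⟨rfl, rfl⟩ := hts
      exact .inr ⟨hok, fun a s' hs' => .inl ⟨w ++ [a], a, hs', rfl, rfl⟩⟩
    · rcases h₂ t T ht with ⟨w', hw'⟩ | ⟨hr, hs⟩
      · refine .inl ⟨w', hw', fun he => hts ?_⟩
        simp only [Set.mem_singleton_iff, Prod.mk.injEq] at he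
        exact ⟨he.1, he.2.1⟩
      · refine .inr ⟨hr, fun a s' hs' => .inr ?_⟩
        rcases hs a s' hs' with ⟨w', hw'⟩ | hcov
        · exact hw'.elim
        · exact hcov
  | prune F T X s S w hmem hbelow =>
    refine ⟨h₁, fun t U ht => (h₂ t U ht).imp_right fun ⟨hr, hs⟩ => ⟨hr, fun a s' hs' => ?_⟩⟩
    rcases hs a s' hs' with ⟨w', hw'⟩ | hcov
    · by_cases he : (s', B.stepSet U a, w') = (s, S, w)
      · simp only [Prod.mk.injEq] at he
        obtain ⟨rfl, rfl, rfl⟩ := he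
        exact .inr hbelow
      · exact .inl ⟨w', hw', he⟩
    · exact .inr hcov
  | add F T X s S w hmem hbelow =>
    refine ⟨fun t ht => (h₁ t ht).add, fun t U ht => ?_⟩
    rcases ht with ⟨ht, -⟩ | ht
    · refine (h₂ t U ht).imp (fun ⟨w', hw'⟩ => ⟨w', .inl hw'⟩) ?_
      refine fun ⟨hr, hs⟩ => ⟨hr, fun a s' hs' => ?_⟩
      rcases hs a s' hs' with ⟨w', hw'⟩ | hcov
      · by_cases he : (s', B.stepSet U a, w') = (s, S, w)
        · simp only [Prod.mk.injEq] at he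
          obtain ⟨rfl, rfl, rfl⟩ := he
          exact .inr ⟨_, .inr rfl, rfl, subset_rfl⟩
        · exact .inl ⟨w', hw', he⟩
      · exact .inr hcov.add
    · simp only [Set.mem_singleton_iff, Prod.mk.injEq] at ht
      obtain ⟨rfl, rfl⟩ := ht
      exact .inl ⟨w, .inr rfl⟩

theorem evalFrom_mono (B : NFA α τ) {S T : Set τ} (h : S ⊆ T) (w : List α) :
    B.evalFrom S w ⊆ B.evalFrom T w := by
  rw [← Set.union_eq_self_of_subset_left h, NFA.evalFrom_union]
  exact Set.subset_union_left

/-- With nothing left in the frontier or in `todo`, every antichain element is explored and all its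
successors are covered. The covering set is smaller, and acceptance is monotone in the set, so the
word can be followed through covering pairs. -/
theorem accepts_of_antichainInvariant {A : NFA α σ} {B : NFA α τ} {X : Set (σ × Set τ)}
    (h : AntichainInvariant A B ⟨∅, X, ∅⟩) (w : List α) (s : σ) (S : Set τ)
    (hs : CoveredBy X (s, S)) (hw : w ∈ A.acceptsFrom {s}) : w ∈ B.acceptsFrom S := by
  induction w generalizing s S with
  | nil =>
    obtain ⟨⟨_, T⟩, hT, rfl, hTS⟩ := hs
    have hs' := by simpa using hw
    rcases h.2 _ _ hT with ⟨w, hw⟩ | ⟨hr, -⟩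
    · exact hw.elim
    · have hne : T ∩ B.accept ≠ ∅ := fun he => hr ⟨hs', he⟩
      obtain ⟨t, ht, ht'⟩ := Set.nonempty_iff_ne_empty.mpr hne
      exact ⟨t, ht', hTS ht⟩
  | cons a w ih =>
    obtain ⟨⟨_, T⟩, hT, rfl, hTS⟩ := hs
    rw [NFA.cons_mem_acceptsFrom, NFA.stepSet_singleton] at hw
    obtain ⟨t, ht, htw⟩ := hw
    obtain ⟨s', hs', htw⟩ := NFA.mem_evalFrom_iff_exists.mp htw
    rcases h.2 _ _ hT with ⟨w, hw⟩ | ⟨-, hstep⟩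
    · exact hw.elim
    · rcases hstep a s' hs' with ⟨w, hw⟩ | hcov
      · exact hw.elim
      · obtain ⟨u, hu, hu'⟩ := ih s' _ hcov ⟨t, ht, htw⟩
        rw [NFA.cons_mem_acceptsFrom]
        refine ⟨u, hu, evalFrom_mono B ?_ w hu'⟩
        intro x hx
        rw [NFA.mem_stepSet] at hx ⊢
        exact hx.imp fun y hy => ⟨hTS hy.1, hy.2⟩

/-- If the antichain algorithm reports success, then the inclusion holds. -/
theorem AntichainAnswer.accepts_subset {A : NFA α σ} {B : NFA α τ}
    (h : AntichainAnswer A B none) : ∀ w ∈ A.accepts, w ∈ B.accepts := by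
  cases h with
  | success X h =>
    have hinv : AntichainInvariant A B ⟨∅, X, ∅⟩ := by
      generalize (⟨∅, X, ∅⟩ : AntichainConfig α σ τ) = c at h
      induction h with
      | refl => exact AntichainInvariant.init A B
      | tail _ hstep ih => exact ih.step hstep
    rintro w ⟨t, ht, htw⟩
    obtain ⟨s, hs, htw⟩ := NFA.mem_evalFrom_iff_exists.mp htw
    exact accepts_of_antichainInvariant hinv w s B.start (hinv.1 s hs) ⟨t, ht, htw⟩

end Antichain

/-- Success is only ever reported by a successful run at some bound; spurious counterexamples merely
raise that bound. -/
theorem CheckFrom.exists_bound {α σ τ : Type} {I : α → α → Prop} {A : NFA α σ} {B : NFA α τ}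
    {k : ℕ} {r : Option (List α)} (h : CheckFrom I A B k r) (hr : r = none) :
    ∃ m : ℕ, AntichainAnswer A (boundedClosure I (m : ℕ∞) B) none := by
  induction h with
  | holds k h => exact ⟨k, h⟩
  | genuine => cases hr
  | spurious k w r h hw _ ih => exact ih hr

/-! ## Commutations of independent symbols -/

section Commutation

variable {α : Type}

/-- The exchange of two adjacent symbols related by `I`. -/
inductive Swap (I : α → α → Prop) : List α → List α → Prop
  | mk (x y : List α) (a b : α) (h : I a b) : Swap I (x ++ a :: b :: y) (x ++ b :: a :: y)

/-- One word can be rewritten into the other by exchanges of adjacent independent symbols. -/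
abbrev Swaps (I : α → α → Prop) : List α → List α → Prop := Relation.ReflTransGen (Swap I)

variable {I : α → α → Prop}

theorem Swaps.context {u w : List α} (h : Swaps I u w) (x y : List α) :
    Swaps I (x ++ u ++ y) (x ++ w ++ y) := by
  refine Relation.ReflTransGen.lift (fun z => x ++ z ++ y) ?_ _ _ h
  rintro _ _ ⟨x', y', a, b, hab⟩
  simpa [Function.onFun] using Swap.mk (x ++ x') (y' ++ y) a b hab

theorem Swaps.move_right (a : α) (η : List α) (h : ∀ b ∈ η, I a b) :
    Swaps I (a :: η) (η ++ [a]) := by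
  induction η with
  | nil => exact .refl
  | cons b η ih =>
    refine .head (Swap.mk [] η a b (h b (by simp))) ?_
    simpa using (ih fun c hc => h c (by simp [hc])).context [b] []

theorem Swaps.move_left (a : α) (η : List α) (h : ∀ b ∈ η, I b a) :
    Swaps I (η ++ [a]) (a :: η) := by
  induction η with
  | nil => exact .refl
  | cons b η ih =>
    refine .tail (b := [b] ++ a :: η) ?_ (Swap.mk [] η b a (h b (by simp)))
    simpa using (ih fun c hc => h c (by simp [hc])).context [b] []

variable {σ : Type}

/-- Here `v` is the word read so far and `v'` the word followed in `B`. The first queue holds the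
symbols of `v'` that `v` still owes, the second those of `v` that `v'` still owes, so appending to
each word what it owes gives words equal up to commutation. Acceptance with empty queues turns this
into the claim, whatever the bound. -/
theorem exists_swaps_of_boundedClosure {k : ℕ∞} {B : NFA α σ} (hI : ∀ a b, I a b → I b a)
    (w : List α) : ∀ (v v' : List α) (q : σ × List α × List α),
      Swaps I (v ++ q.2.1) (v' ++ q.2.2) → w ∈ (boundedClosure I k B).acceptsFrom {q} →
      ∃ u ∈ B.acceptsFrom {q.1}, Swaps I (v ++ w) (v' ++ u) := by
  induction w with
  | nil =>
    intro v v' q hv hw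
    rw [NFA.nil_mem_acceptsFrom] at hw
    obtain ⟨_, rfl, hq, hη⟩ := hw
    refine ⟨[], (NFA.nil_mem_acceptsFrom _).mpr ⟨_, rfl, hq⟩, ?_⟩
    simpa [hη] using hv
  | cons a w ih =>
    rintro v v' ⟨s, η₁, η₂⟩ hv hw
    rw [NFA.cons_mem_acceptsFrom, NFA.stepSet_singleton] at hw
    obtain ⟨t, ht, htw⟩ := hw
    obtain ⟨⟨s', ζ₁, ζ₂⟩, ⟨b, μ₁, μ₂, hb, ha, hb', -, -⟩, htw⟩ :=
      NFA.mem_evalFrom_iff_exists.mp htw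
    simp only at hv hb ha hb'
    -- The new symbol moves right through `η₁`: to its end if it is queued, up to the place of its
    -- twin if it is cancelled.
    have h₁ : Swaps I (v ++ [a] ++ μ₁) (v' ++ μ₂) := by
      rcases ha with ⟨-, hind, rfl, rfl⟩ | ⟨x, y, rfl, hind, rfl, rfl⟩
      · have := (Swaps.move_right a μ₁ hind).context v []
        have h' := hv.context [] [a]
        simp only [List.append_nil, List.nil_append, List.append_assoc] at this h' ⊢
        exact this.trans h'
      · have := (Swaps.move_right a x hind).context v y
        simp only [List.append_assoc, List.cons_append, List.nil_append] at this ⊢ hv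
        exact this.trans hv
    -- Now `b` has to move left on the target side, which is where the symmetry of `I` enters.
    have h₂ : Swaps I (v ++ [a] ++ ζ₁) (v' ++ [b] ++ ζ₂) := by
      rcases hb' with ⟨-, hind, rfl, rfl⟩ | ⟨x, y, rfl, hind, rfl, rfl⟩
      · have := (Swaps.move_left b ζ₂ fun c hc => hI _ _ (hind c hc)).context v' []
        have h' := h₁.context [] [b]
        simp only [List.append_nil, List.nil_append, List.append_assoc, List.cons_append]
          at this h' ⊢
        exact h'.trans this
      · have := (Swaps.move_left b x fun c hc => hI _ _ (hind c hc)).context v' y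
        simp only [List.append_assoc, List.cons_append, List.nil_append] at this h₁ ⊢
        exact h₁.trans this
    obtain ⟨u, ⟨r, hr, hu⟩, hsw⟩ := ih (v ++ [a]) (v' ++ [b]) (s', ζ₁, ζ₂) h₂ ⟨t, ht, htw⟩
    refine ⟨b :: u, ?_, by simpa using hsw⟩
    rw [NFA.cons_mem_acceptsFrom, NFA.stepSet_singleton]
    exact ⟨r, hr, NFA.mem_evalFrom_iff_exists.mpr ⟨s', hb, hu⟩⟩

/-- The closure automaton accepts only words that are equivalent to words of `B`. -/
theorem exists_swaps_of_mem_boundedClosure {k : ℕ∞} {B : NFA α σ}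
    (hI : ∀ a b, I a b → I b a) {w : List α} (hw : w ∈ (boundedClosure I k B).accepts) :
    ∃ u ∈ B.accepts, Swaps I w u := by
  obtain ⟨t, ht, htw⟩ := hw
  obtain ⟨q, ⟨hq, hη⟩, htw⟩ := NFA.mem_evalFrom_iff_exists.mp htw
  obtain ⟨u, ⟨r, hr, hu⟩, hsw⟩ := exists_swaps_of_boundedClosure hI w [] [] q
    (by rw [hη]) ⟨t, ht, htw⟩
  exact ⟨u, ⟨r, hr, NFA.mem_evalFrom_iff_exists.mpr ⟨_, hq, hu⟩⟩, hsw⟩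

end Commutation

theorem Indep.symm {n : ℕ} {a b : AbsSym n} (h : Indep a b) : Indep b a :=
  ⟨h.1.symm, h.2.imp Ne.symm And.symm⟩

/-! ## The automaton of the abstract observation sequences -/

theorem Run.trans {D O : Type} {n : ℕ} {R : ThreadSem D O n} {μ : Mode} {p q r : State D n}
    {u w : List O} (h : Run R μ p u q) (h' : Run R μ q w r) : Run R μ p (u ++ w) r := by
  induction h with
  | refl => exact h'
  | head p q _ α w hs _ ih => rw [List.append_assoc]; exact .head _ _ _ _ _ hs (ih h')

section Automaton

variable {n : ℕ} {μ : Mode} {c₀ : CondVar → Bool} {C : Program n}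

theorem isPath_emit (p : State Unit n) (w : List (AbsSym n)) :
    (absEpsAutomaton μ c₀ C).IsPath (p, w) (p, []) (w.map some) := by
  induction w with
  | nil => exact .nil _
  | cons a w ih => exact .cons (p, w) _ _ _ _ ⟨rfl, rfl⟩ ih

theorem Run.exists_isPath {p q : State Unit n} {w : List (AbsSym n)}
    (h : Run AbstractStep μ p w q) :
    ∃ x, x.reduceOption = w ∧ (absEpsAutomaton μ c₀ C).IsPath (p, []) (q, []) x := by
  induction h with
  | refl p => exact ⟨[], rfl, .nil _⟩
  | head p q r α w hs _ ih =>
    obtain ⟨x, rfl, hx⟩ := ih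
    -- One ε-transition performs the step and loads its word, which is then emitted symbol by
    -- symbol.
    refine ⟨none :: (α.map some ++ x), ?_, .cons (q, α) _ _ _ _ ⟨rfl, hs⟩ ?_⟩
    · rw [List.reduceOption_cons_of_none, List.reduceOption_append]
      simp [List.reduceOption]
    · exact (εNFA.isPath_append _).mpr ⟨_, isPath_emit q α, hx⟩

/-- A path may start in the middle of an emission, so the pending symbols come in front of the word
of the run. -/
theorem run_of_isPath {s t : AutState n} {x : List (Option (AbsSym n))}
    (h : (absEpsAutomaton μ c₀ C).IsPath s t x) (ht : t.2 = []) :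
    ∃ w, x.reduceOption = s.2 ++ w ∧ Run AbstractStep μ s.1 w t.1 := by
  induction h with
  | nil s => exact ⟨[], by simp [ht, List.reduceOption], .refl _⟩
  | cons t s u a x hstep _ ih =>
    obtain ⟨w, hx, hw⟩ := ih ht
    cases a with
    | none =>
      obtain ⟨hs, hst⟩ := hstep
      exact ⟨t.2 ++ w, by simpa [hs] using hx, .head _ _ _ _ _ hst hw⟩
    | some a =>
      obtain ⟨hs, hst⟩ := hstep
      exact ⟨w, by simpa [hs] using hx, hst ▸ hw⟩

theorem mem_accepts_absAutomaton_iff {w : List (AbsSym n)} :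
    w ∈ (absAutomaton μ c₀ C).accepts ↔ w ∈ obsSeqs AbstractStep μ () c₀ C := by
  rw [absAutomaton, εNFA.toNFA_correct, εNFA.mem_accepts_iff_exists_path]
  constructor
  · rintro ⟨_, ⟨p, _⟩, x, rfl, ⟨rfl, hp⟩, rfl, hx⟩
    obtain ⟨w, hw, hrun⟩ := run_of_isPath hx rfl
    exact ⟨p, by rw [hw]; exact hrun, hp⟩
  · rintro ⟨p, hrun, hp⟩
    obtain ⟨x, hx, hpath⟩ := hrun.exists_isPath (c₀ := c₀) (C := C)
    exact ⟨_, (p, []), x, rfl, ⟨rfl, hp⟩, hx, hpath⟩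

end Automaton

/-- What a successful check guarantees for the abstract observation sequences. -/
theorem Check.exists_swaps {n : ℕ} {c₀ : CondVar → Bool} {C' C : Program n}
    (h : Check c₀ C' C none) {w : List (AbsSym n)}
    (hw : w ∈ obsSeqs AbstractStep .preemptive () c₀ C') :
    ∃ u ∈ obsSeqs AbstractStep .nonpreemptive () c₀ C, Swaps Indep w u := by
  obtain ⟨k, -, h⟩ := h
  obtain ⟨m, hm⟩ := h.exists_bound rfl
  obtain ⟨u, hu, hsw⟩ := exists_swaps_of_mem_boundedClosure (fun _ _ => Indep.symm)
    (hm.accepts_subset w (mem_accepts_absAutomaton_iff.mpr hw))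
  exact ⟨u, mem_accepts_absAutomaton_iff.mp hu, hsw⟩

/-! ## Headers of data statements -/

/-- The data statements of the language, without the bodies of loops and conditionals. -/
inductive Header : Type
  | assign (l : Loc) (x : Var) (e : Expr) : Header
  | havoc (l : Loc) (x : Var) : Header
  | cond (l : Loc) (e : Expr) : Header
  | input (l : Loc) (x : Var) (t : Tag) : Header
  | output (l : Loc) (t : Tag) (e : Expr) : Header

namespace Header

def loc : Header → Loc
  | assign l _ _ => l
  | havoc l _ => l
  | cond l _ => l
  | input l _ _ => l
  | output l _ _ => l

/-- The number of abstract symbols that an execution emits. -/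
def size : Header → ℕ
  | assign _ _ e => e.reads.length + 1
  | havoc _ _ => 1
  | cond _ e => e.reads.length + 1
  | input _ _ _ => 2
  | output _ _ e => e.reads.length + 1

theorem size_pos (h : Header) : 0 < h.size := by cases h <;> simp [size]

end Header

/-- The headers of the data statements in a statement. -/
def Stmt.headers : Stmt → List Header
  | assign l x e => [.assign l x e]
  | havoc l x => [.havoc l x]
  | ite l e s₁ s₂ => .cond l e :: (s₁.headers ++ s₂.headers)
  | .while l e s => .cond l e :: s.headers
  | input l x t => [.input l x t]
  | output l t e => [.output l t e]
  | seq s₁ s₂ => s₁.headers ++ s₂.headers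
  | _ => []

theorem Stmt.map_loc_headers_sublist (s : Stmt) : (s.headers.map Header.loc).Sublist s.locs := by
  induction s with
  | ite l e s₁ s₂ h₁ h₂ =>
    simpa [headers, locs, Header.loc] using h₁.append h₂
  | seq s₁ s₂ h₁ h₂ => simpa [headers, locs] using h₁.append h₂
  | _ => simp_all [headers, locs, Header.loc]

/-- This is where unique locations are used: abstract symbols show only a location, and it has to
identify the statement that emitted them. -/
theorem Program.UniqueLocs.header_eq {n : ℕ} {C : Program n} (hC : C.UniqueLocs) {i : Fin n}
    {h h' : Header} (hh : h ∈ (C i).headers) (hh' : h' ∈ (C i).headers) (he : h.loc = h'.loc) :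
    h = h' :=
  List.inj_on_of_nodup_map ((hC i).sublist (C i).map_loc_headers_sublist) hh hh' he

/-- Headers do not depend on how sequential compositions are nested, so a block may be rewritten as
a plain list. -/
theorem Stmt.headers_eq_flatMap_block (s : Stmt) : s.headers = s.block.flatMap headers := by
  induction s with
  | seq s₁ s₂ h₁ h₂ => simp [headers, block, h₁, h₂]
  | _ => simp [block]

theorem RewriteBlock.headers_subset {T : List Stmt → List Stmt → Prop}
    (hT : ∀ L L', T L L' → L'.flatMap Stmt.headers ⊆ L.flatMap Stmt.headers) {s s' : Stmt}
    (h : RewriteBlock T s s') : s'.headers ⊆ s.headers := by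
  induction h with
  | here s s' h =>
    rw [s.headers_eq_flatMap_block, s'.headers_eq_flatMap_block]
    exact hT _ _ h
  | _ =>
    intro x hx
    simp only [Stmt.headers, List.mem_cons, List.mem_append] at hx ⊢
    grind

theorem LockSegment.headers_subset {m : LockVar} {a b l l' : Loc} (L L' : List Stmt)
    (h : LockSegment m a b l l' L L') : L'.flatMap Stmt.headers ⊆ L.flatMap Stmt.headers := by
  obtain ⟨pre, mid, post, rfl, -, -, rfl⟩ := h
  simp [Stmt.headers]

theorem MoveSignal.headers_subset {l l' : Loc} (L L' : List Stmt)
    (h : MoveSignal l l' L L') : L'.flatMap Stmt.headers ⊆ L.flatMap Stmt.headers := by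
  obtain ⟨c, pre, mid, post, rfl, -, rfl⟩ := h
  simp [Stmt.headers]

section Candidates

variable {n : ℕ} {C P P' : Program n}

theorem headers_update_subset {i : Fin n} {s : Stmt} (h : s.headers ⊆ (P i).headers)
    (j : Fin n) : (Function.update P i s j).headers ⊆ (P j).headers := by
  by_cases hj : j = i
  · subst hj; simpa using h
  · simp [hj]

theorem InsertLock.headers_subset {m : LockVar} {i : Fin n} {l l' : Loc}
    (h : InsertLock m i l l' P P') (j : Fin n) : (P' j).headers ⊆ (P j).headers := by
  obtain ⟨a, b, s, -, -, -, hs, rfl⟩ := h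
  exact headers_update_subset (hs.headers_subset LockSegment.headers_subset) j

theorem ApplyFix.headers_subset {f : Fix n} (h : ApplyFix C f P P') (j : Fin n) :
    (P' j).headers ⊆ (P j).headers := by
  cases h with
  | lock i l l' k r r' m P P₁ P₂ hm h₁ h₂ =>
    exact List.Subset.trans (h₂.headers_subset j) (h₁.headers_subset j)
  | reorder i l l' P s h =>
    exact headers_update_subset (h.headers_subset MoveSignal.headers_subset) j

theorem ApplyFixes.headers_subset {fs : List (Fix n)} (h : ApplyFixes C fs P P') (j : Fin n) :
    (P' j).headers ⊆ (P j).headers := by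
  induction h with
  | nil => exact List.Subset.refl _
  | cons _ _ _ _ _ h _ ih => exact List.Subset.trans ih (h.headers_subset j)

/-- Fixes insert lock operations and move signals, neither of which has a header. Bodies of loops
and conditionals may change, which is why headers and not whole statements are compared. -/
theorem Candidate.headers_subset {c₀ : CondVar → Bool} (h : Candidate c₀ C P) (j : Fin n) :
    (P j).headers ⊆ (C j).headers := by
  induction h with
  | original => exact List.Subset.refl _
  | refine _ _ _ _ _ _ _ _ _ happ ih => exact List.Subset.trans (happ.headers_subset j) ih

end Candidates

/-! ## Annotated symbols -/

/-- An abstract symbol together with the value that is read or written and with the concrete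
symbols emitted. -/
structure AnnSym (n : ℕ) where
  sym : AbsSym n
  val : ℤ
  obs : List (Obs n)

namespace AnnSym

variable {n : ℕ}

/-- The symbol may occur under the valuation `v`. -/
def ReadsFrom (a : AnnSym n) (v : Var → ℤ) : Prop :=
  a.sym.act = .read → ∀ x, a.sym.mem = some (.var x) → a.val = v x

open Classical in
/-- The valuation after the symbol. -/
noncomputable def write (a : AnnSym n) (v : Var → ℤ) : Var → ℤ :=
  fun x => if a.sym.act = .write ∧ a.sym.mem = some (.var x) then a.val else v x

/-- The interface symbols come from writes to the external interface, and the havoc symbols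
belong to the thread of the abstract symbol. -/
def WellFormed (a : AnnSym n) : Prop :=
  (∀ o ∈ a.obs, o.isInterface = true → a.sym.act = .write ∧ a.sym.mem = some .dev) ∧
    ∀ o ∈ a.obs, ∀ j, o.isHavocOf j = true → j = a.sym.tid

theorem write_of_act_ne {a : AnnSym n} (h : a.sym.act ≠ .write) (v : Var → ℤ) :
    a.write v = v := by
  funext x; simp [write, h]

/-- A read of a variable that `a` writes would share its memory location with a write, and so would
depend on `a`. -/
theorem readsFrom_write_iff {a b : AnnSym n} (h : Indep a.sym b.sym) (v : Var → ℤ) :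
    b.ReadsFrom (a.write v) ↔ b.ReadsFrom v := by
  refine forall_congr' fun hr => forall_congr' fun x => forall_congr' fun hx => ?_
  have : ¬ (a.sym.act = .write ∧ a.sym.mem = some (.var x)) := by
    rintro ⟨ha, hm⟩
    rcases h.2 with h | h
    · exact h (hm.trans hx.symm)
    · exact h.1 ha
  simp [write, this]

theorem write_comm {a b : AnnSym n} (h : Indep a.sym b.sym) (v : Var → ℤ) :
    a.write (b.write v) = b.write (a.write v) := by
  funext x
  by_cases ha : a.sym.act = .write ∧ a.sym.mem = some (.var x)
  · have hb : ¬ (b.sym.act = .write ∧ b.sym.mem = some (.var x)) := by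
      rintro ⟨hb, hm⟩
      rcases h.2 with h | h
      · exact h (ha.2.trans hm.symm)
      · exact h.1 ha.1
    simp [write, ha, hb]
  · simp [write, ha]

end AnnSym

section Replay

variable {n : ℕ}

/-- Executing the annotated word from the valuation `v` leads to `v'`, and each read returns the
current value of the variable. -/
def Replays (v : Var → ℤ) : List (AnnSym n) → (Var → ℤ) → Prop
  | [], v' => v' = v
  | a :: W, v' => a.ReadsFrom v ∧ Replays (a.write v) W v'

theorem replays_append {v v' : Var → ℤ} {U W : List (AnnSym n)} :
    Replays v (U ++ W) v' ↔ ∃ v'', Replays v U v'' ∧ Replays v'' W v' := by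
  induction U generalizing v with
  | nil => simp [Replays]
  | cons a U ih => simp [Replays, ih, and_assoc]

/-- The concrete observation sequence of an annotated word. -/
def obsOf (W : List (AnnSym n)) : List (Obs n) := W.flatMap AnnSym.obs

theorem obsOf_append (U W : List (AnnSym n)) : obsOf (U ++ W) = obsOf U ++ obsOf W := by
  simp [obsOf]

/-- The part of an annotated word that belongs to thread `i`. -/
def threadPart (i : Fin n) (W : List (AnnSym n)) : List (AnnSym n) :=
  W.filter fun a => decide (a.sym.tid = i)

theorem threadPart_append (i : Fin n) (U W : List (AnnSym n)) :
    threadPart i (U ++ W) = threadPart i U ++ threadPart i W := by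
  simp [threadPart]

theorem threadPart_eq_self {i : Fin n} {W : List (AnnSym n)} (h : ∀ a ∈ W, a.sym.tid = i) :
    threadPart i W = W := by
  simpa [threadPart] using h

theorem threadPart_eq_nil {i j : Fin n} {W : List (AnnSym n)} (h : ∀ a ∈ W, a.sym.tid = i)
    (hj : j ≠ i) : threadPart j W = [] := by
  simp only [threadPart, List.filter_eq_nil_iff, decide_eq_true_eq]
  exact fun a ha he => hj (he.symm.trans (h a ha))

/-- Independence of annotated symbols. -/
def AnnIndep (a b : AnnSym n) : Prop := Indep a.sym b.sym

variable {U W : List (AnnSym n)}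

/-- Neither symbol affects what the other reads, and their writes hit different variables, so even
the final valuation is unchanged. -/
theorem Swap.replays (h : Swap AnnIndep U W) {v v' : Var → ℤ} (hU : Replays v U v') :
    Replays v W v' := by
  obtain ⟨x, y, a, b, hab⟩ := h
  rw [replays_append] at hU ⊢
  obtain ⟨v₁, hx, ha, hb, hy⟩ := hU
  refine ⟨v₁, hx, (AnnSym.readsFrom_write_iff hab _).mp hb,
    (AnnSym.readsFrom_write_iff hab.symm _).mpr ha, ?_⟩
  rwa [AnnSym.write_comm hab]

/-- Independent symbols belong to different threads, so at most one of them survives the filter. -/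
theorem Swap.threadPart_eq (h : Swap AnnIndep U W) (i : Fin n) :
    threadPart i U = threadPart i W := by
  obtain ⟨x, y, a, b, hab⟩ := h
  have := hab.1
  by_cases ha : a.sym.tid = i <;> by_cases hb : b.sym.tid = i <;>
    simp_all [threadPart]

theorem Swap.mem_iff {α : Type} {I : α → α → Prop} {u w : List α} (h : Swap I u w) (a : α) :
    a ∈ u ↔ a ∈ w := by
  obtain ⟨x, y, b, c, -⟩ := h
  simp only [List.mem_append, List.mem_cons]
  tauto

theorem filter_append_comm {α : Type} (p : α → Bool) (x y u w : List α)
    (h : u.filter p = [] ∨ w.filter p = []) :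
    (x ++ (u ++ (w ++ y))).filter p = (x ++ (w ++ (u ++ y))).filter p := by
  rcases h with h | h <;> simp [h]

/-- Interface symbols sit on writes to `dev`, and two of these are never independent. Havoc symbols
of one thread sit on abstract symbols of that thread, which never commute. So under each filter at
most one of the exchanged words is nonempty. -/
theorem Swap.equivalent (h : Swap AnnIndep U W) (hU : ∀ a ∈ U, a.WellFormed) :
    Obs.Equivalent (obsOf U) (obsOf W) := by
  obtain ⟨x, y, a, b, hab⟩ := h
  have ha : a.WellFormed := hU a (by simp)
  have hb : b.WellFormed := hU b (by simp)
  simp only [obsOf, List.flatMap_append, List.flatMap_cons]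
  refine ⟨filter_append_comm _ _ _ _ _ ?_, fun i => filter_append_comm _ _ _ _ _ ?_⟩
  · by_contra! hne
    obtain ⟨o, ho⟩ := List.exists_mem_of_ne_nil _ hne.1
    obtain ⟨o', ho'⟩ := List.exists_mem_of_ne_nil _ hne.2
    rw [List.mem_filter] at ho ho'
    have h₁ := ha.1 o ho.1 ho.2
    have h₂ := hb.1 o' ho'.1 ho'.2
    rcases hab.2 with h | h
    · exact h (h₁.2.trans h₂.2.symm)
    · exact h.1 h₁.1
  · by_contra! hne
    obtain ⟨o, ho⟩ := List.exists_mem_of_ne_nil _ hne.1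
    obtain ⟨o', ho'⟩ := List.exists_mem_of_ne_nil _ hne.2
    rw [List.mem_filter] at ho ho'
    exact hab.1 ((ha.2 o ho.1 i ho.2).symm.trans (hb.2 o' ho'.1 i ho'.2))

theorem Obs.Equivalent.trans {u v w : List (Obs n)} (h : Obs.Equivalent u v)
    (h' : Obs.Equivalent v w) : Obs.Equivalent u w :=
  ⟨h.1.trans h'.1, fun i => (h.2 i).trans (h'.2 i)⟩

/-- Commutations of the abstract symbols lift to annotated words. -/
theorem Swaps.exists_annotated {u w : List (AbsSym n)} (h : Swaps Indep u w)
    (hU : U.map AnnSym.sym = u) (hwf : ∀ a ∈ U, a.WellFormed) :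
    ∃ W : List (AnnSym n), W.map AnnSym.sym = w ∧
      (∀ v v', Replays v U v' → Replays v W v') ∧ (∀ i, threadPart i U = threadPart i W) ∧
      (∀ a ∈ W, a.WellFormed) ∧ Obs.Equivalent (obsOf U) (obsOf W) := by
  induction h with
  | refl => exact ⟨U, hU, fun _ _ h => h, fun _ => rfl, hwf, rfl, fun _ => rfl⟩
  | tail _ hstep ih =>
    obtain ⟨W, hW, hr, ht, hwf', he⟩ := ih
    obtain ⟨x, y, a, b, hab⟩ := hstep
    -- The position of the abstract exchange is pulled back through `AnnSym.sym` to the annotated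
    -- word.
    obtain ⟨X, R, rfl, rfl, hR₁⟩ := List.map_eq_append_iff.mp hW
    obtain ⟨a, R, rfl, rfl, hR₂⟩ := List.map_eq_cons_iff.mp hR₁
    obtain ⟨b, Y, rfl, rfl, rfl⟩ := List.map_eq_cons_iff.mp hR₂
    have hs : Swap AnnIndep (X ++ a :: b :: Y) (X ++ b :: a :: Y) := .mk X Y a b hab
    exact ⟨_, by simp, fun v v' h => hs.replays (hr v v' h),
      fun i => (ht i).trans (hs.threadPart_eq i),
      fun c hc => hwf' c ((hs.mem_iff c).mpr hc), he.trans (hs.equivalent hwf')⟩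

end Replay

/-! ## Executions of data statements -/

theorem Expr.eval_congr {v w : Var → ℤ} (e : Expr) (h : ∀ x ∈ e.reads, v x = w x) :
    e.eval v = e.eval w := by
  induction e with
  | var x => exact h x (by simp [reads])
  | const k => rfl
  | op m f args ih =>
    refine congrArg f (funext fun i => ih i fun x hx => h x ?_)
    simp only [reads, List.mem_flatten, List.mem_ofFn]
    exact ⟨_, ⟨i, rfl⟩, hx⟩

section Blocks

variable {n : ℕ}

/-- The annotated reads made when `e` is evaluated at `l` under the valuation `ρ`. -/
def readAnns (i : Fin n) (e : Expr) (l : Loc) (ρ : Var → ℤ) : List (AnnSym n) :=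
  e.reads.map fun x => ⟨⟨i, .read, some (.var x), l⟩, ρ x, []⟩

theorem map_sym_readAnns (i : Fin n) (e : Expr) (l : Loc) (ρ : Var → ℤ) :
    (readAnns i e l ρ).map AnnSym.sym = readSyms i e l := by
  simp [readAnns, readSyms]

theorem obsOf_readAnns (i : Fin n) (e : Expr) (l : Loc) (ρ : Var → ℤ) :
    obsOf (readAnns i e l ρ) = [] := by
  simp [readAnns, obsOf]

theorem obsOf_readAnns_append (i : Fin n) (e : Expr) (l : Loc) (ρ : Var → ℤ) (a : AnnSym n) :
    obsOf (readAnns i e l ρ ++ [a]) = a.obs := by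
  rw [obsOf_append, obsOf_readAnns]
  simp [obsOf]

theorem length_readAnns (i : Fin n) (e : Expr) (l : Loc) (ρ : Var → ℤ) :
    (readAnns i e l ρ).length = e.reads.length := by
  simp [readAnns]

/-- Replaying reads leaves the valuation alone and forces the recorded one to agree with it on the
variables read; this is all an expression needs for its value. -/
theorem replays_readAnns {i : Fin n} {e : Expr} {l : Loc} {ρ v v' : Var → ℤ} :
    Replays v (readAnns i e l ρ) v' ↔ v' = v ∧ ∀ x ∈ e.reads, ρ x = v x := by
  unfold readAnns
  induction e.reads with
  | nil => simp [Replays]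
  | cons x xs ih =>
    rw [List.map_cons, Replays, AnnSym.write_of_act_ne (by simp), ih]
    simp [AnnSym.ReadsFrom]
    tauto

/-- The annotated words of executions of a data statement of thread `i`, when only the variables
that are read are known. -/
inductive Block (i : Fin n) : Header → List (AnnSym n) → Prop
  | assign (l : Loc) (x : Var) (e : Expr) (ρ : Var → ℤ) :
      Block i (.assign l x e)
        (readAnns i e l ρ ++ [⟨⟨i, .write, some (.var x), l⟩, e.eval ρ, []⟩])
  | havoc (l : Loc) (x : Var) (k : ℕ) :
      Block i (.havoc l x) [⟨⟨i, .write, some (.var x), l⟩, k, [.havoc i k x]⟩]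
  | condTrue (l : Loc) (e : Expr) (ρ : Var → ℤ) (a : Act) (ha : a = .loop ∨ a = .thenBranch)
      (he : e.IsTrue ρ) :
      Block i (.cond l e) (readAnns i e l ρ ++ [⟨⟨i, a, none, l⟩, 0, []⟩])
  | condFalse (l : Loc) (e : Expr) (ρ : Var → ℤ) (a : Act) (ha : a = .exit ∨ a = .elseBranch)
      (he : ¬ e.IsTrue ρ) :
      Block i (.cond l e) (readAnns i e l ρ ++ [⟨⟨i, a, none, l⟩, 0, []⟩])
  | input (l : Loc) (x : Var) (t : Tag) (k : ℕ) :
      Block i (.input l x t) [⟨⟨i, .write, some .dev, l⟩, k, [.input i k t]⟩,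
        ⟨⟨i, .write, some (.var x), l⟩, k, []⟩]
  | output (l : Loc) (t : Tag) (e : Expr) (ρ : Var → ℤ) :
      Block i (.output l t e) (readAnns i e l ρ ++
        [⟨⟨i, .write, some .dev, l⟩, e.eval ρ, [.output i (e.eval ρ) t]⟩])

variable {i : Fin n} {h : Header} {A : List (AnnSym n)}

theorem Block.length_eq (hA : Block i h A) : A.length = h.size := by
  cases hA <;> simp [Header.size, length_readAnns]

theorem Block.of_mem (hA : Block i h A) {a : AnnSym n} (ha : a ∈ A) :
    a.sym.tid = i ∧ a.sym.loc = h.loc ∧ a.WellFormed := by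
  cases hA <;> simp only [readAnns, List.mem_append, List.mem_map,
    List.mem_cons, List.not_mem_nil, or_false] at ha <;>
  rcases ha with ⟨x, -, rfl⟩ | rfl <;>
  simp [Header.loc, AnnSym.WellFormed, Obs.isInterface, Obs.isHavocOf]

theorem Block.ne_nil (hA : Block i h A) : A ≠ [] := by
  rw [← List.length_pos_iff, hA.length_eq]
  exact h.size_pos

/-- The word is a sequence of executions of data statements of thread `i` with headers in `H`. -/
inductive BlockSeq (i : Fin n) (H : List Header) : List (AnnSym n) → Prop
  | nil : BlockSeq i H []
  | cons (h : Header) (A W : List (AnnSym n)) (hh : h ∈ H) (hA : Block i h A)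
      (hW : BlockSeq i H W) : BlockSeq i H (A ++ W)

/-- If headers have unique locations, a prefix with the location and the length of a block is a
block. -/
theorem BlockSeq.of_append {H : List Header} {W : List (AnnSym n)}
    (hH : ∀ h ∈ H, ∀ h' ∈ H, h.loc = h'.loc → h = h') (hW : BlockSeq i H (A ++ W))
    (hh : h ∈ H) (hlen : A.length = h.size) (hloc : ∀ a ∈ A, a.sym.loc = h.loc) :
    Block i h A ∧ BlockSeq i H W := by
  generalize hV : A ++ W = V at hW
  have hA : A ≠ [] := by
    rw [← List.length_pos_iff, hlen]
    exact h.size_pos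
  cases hW with
  | nil => exact (hA (List.append_eq_nil_iff.mp hV).1).elim
  | cons h' A' W' hh' hA' hW' =>
    -- Both words are nonempty with the same first symbol, whose location names both headers.
    have hl : h = h' := by
      obtain ⟨a, A₁, rfl⟩ := List.exists_cons_of_ne_nil hA
      obtain ⟨a', A₁', rfl⟩ := List.exists_cons_of_ne_nil hA'.ne_nil
      rw [List.cons_append, List.cons_append, List.cons.injEq] at hV
      refine hH _ hh _ hh' ?_
      rw [← hloc a (by simp), hV.1, (hA'.of_mem (by simp)).2.1]
    subst hl
    -- The number of symbols depends on the header alone, so the two prefixes are cut at the same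
    -- place.
    obtain ⟨rfl, rfl⟩ := List.append_inj hV (hlen.trans hA'.length_eq.symm)
    exact ⟨hA', hW'⟩

end Blocks

/-! ## From concrete to abstract executions -/

section Annotate

variable {n : ℕ}

/-- Forget the data of a store. -/
def Store.forget {D : Type} (σ : Store D n) : Store Unit n := ⟨(), σ.lock, σ.cond⟩

/-- Forget the data of a state. -/
def State.forget {D : Type} (p : State D n) : State Unit n := ⟨p.store.forget, p.ctid, p.prog⟩

/-- The word is empty or a block of thread `i` with a header in `H`. -/
def OptBlock (i : Fin n) (H : List Header) (A : List (AnnSym n)) : Prop :=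
  A = [] ∨ ∃ h ∈ H, Block i h A

theorem OptBlock.mono {i : Fin n} {H H' : List Header} {A : List (AnnSym n)}
    (h : OptBlock i H A) (hH : H ⊆ H') : OptBlock i H' A :=
  h.imp_right fun ⟨hd, hh, hA⟩ => ⟨hd, hH hh, hA⟩

/-- Unrolling a loop repeats the headers of its body, so the claim is an inclusion and not a sublist
relation. -/
theorem ConcreteStep.headers_subset {i : Fin n} {v v' : Var → ℤ} {s s' : Stmt}
    {α : List (Obs n)} (h : ConcreteStep i v s α v' s') : s'.headers ⊆ s.headers := by
  induction h <;> intro x hx <;>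
    simp only [Stmt.headers, List.mem_cons, List.mem_append, List.not_mem_nil] at hx ⊢ <;> grind

theorem replays_block {i : Fin n} {e : Expr} {l : Loc} {ρ v v' : Var → ℤ} {a : AnnSym n} :
    Replays v (readAnns i e l ρ ++ [a]) v' ↔
      (∀ x ∈ e.reads, ρ x = v x) ∧ a.ReadsFrom v ∧ v' = a.write v := by
  rw [replays_append]
  constructor
  · rintro ⟨_, h, hr, h'⟩
    obtain ⟨rfl, h⟩ := replays_readAnns.mp h
    exact ⟨h, hr, h'⟩
  · rintro ⟨h, hr, h'⟩
    exact ⟨v, replays_readAnns.mpr ⟨rfl, h⟩, hr, h'⟩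

theorem AnnSym.write_var {a : AnnSym n} {x : Var} (ha : a.sym.act = .write)
    (hm : a.sym.mem = some (.var x)) (v : Var → ℤ) : a.write v = Function.update v x a.val := by
  funext y
  by_cases h : y = x
  · subst h; simp [write, ha, hm]
  · simp [write, hm, h, Ne.symm h]

theorem AnnSym.write_of_mem_ne {a : AnnSym n} (h : ∀ x, a.sym.mem ≠ some (.var x))
    (v : Var → ℤ) : a.write v = v := by
  funext x; simp [write, h]

theorem AnnSym.readsFrom_of_act_ne {a : AnnSym n} (h : a.sym.act ≠ .read) (v : Var → ℤ) :
    a.ReadsFrom v :=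
  fun h' => (h h').elim

/-- The recorded valuation is the current one, so the reads replay trivially and the last symbols of
the block perform the update. -/
theorem ConcreteStep.annotate {i : Fin n} {v v' : Var → ℤ} {s s' : Stmt} {α : List (Obs n)}
    (h : ConcreteStep i v s α v' s') :
    ∃ A, OptBlock i s.headers A ∧ obsOf A = α ∧ Replays v A v' ∧
      AbstractStep i () s (A.map AnnSym.sym) () s' := by
  induction h with
  | assign i v l x e =>
    refine ⟨_, .inr ⟨_, List.mem_singleton_self _, .assign l x e v⟩, ?_, ?_, ?_⟩
    · rw [obsOf_readAnns_append]
    · exact replays_block.mpr ⟨fun _ _ => rfl, AnnSym.readsFrom_of_act_ne (by simp) _,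
        by rw [AnnSym.write_var rfl rfl]⟩
    · simpa [map_sym_readAnns] using AbstractStep.assign i l x e
  | havoc i v l x k =>
    refine ⟨_, .inr ⟨_, List.mem_singleton_self _, .havoc l x k⟩, rfl, ?_, .havoc i l x⟩
    exact ⟨AnnSym.readsFrom_of_act_ne (by simp) _, by rw [Replays, AnnSym.write_var rfl rfl]⟩
  | while_exit i v l e s h =>
    refine ⟨_, .inr ⟨.cond l e, by simp [Stmt.headers], .condFalse l e v .exit (.inl rfl) h⟩,
      ?_, ?_, ?_⟩
    · rw [obsOf_readAnns_append]
    · exact replays_block.mpr ⟨fun _ _ => rfl, AnnSym.readsFrom_of_act_ne (by simp) _,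
        (AnnSym.write_of_act_ne (by simp) _).symm⟩
    · simpa [map_sym_readAnns] using AbstractStep.while_exit i l e s
  | while_loop i v l e s h =>
    refine ⟨_, .inr ⟨.cond l e, by simp [Stmt.headers], .condTrue l e v .loop (.inl rfl) h⟩,
      ?_, ?_, ?_⟩
    · rw [obsOf_readAnns_append]
    · exact replays_block.mpr ⟨fun _ _ => rfl, AnnSym.readsFrom_of_act_ne (by simp) _,
        (AnnSym.write_of_act_ne (by simp) _).symm⟩
    · simpa [map_sym_readAnns] using AbstractStep.while_loop i l e s
  | ite_then i v l e s₁ s₂ h =>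
    refine ⟨_, .inr ⟨.cond l e, by simp [Stmt.headers], .condTrue l e v .thenBranch (.inr rfl) h⟩,
      ?_, ?_, ?_⟩
    · rw [obsOf_readAnns_append]
    · exact replays_block.mpr ⟨fun _ _ => rfl, AnnSym.readsFrom_of_act_ne (by simp) _,
        (AnnSym.write_of_act_ne (by simp) _).symm⟩
    · simpa [map_sym_readAnns] using AbstractStep.ite_then i l e s₁ s₂
  | ite_else i v l e s₁ s₂ h =>
    refine ⟨_, .inr ⟨.cond l e, by simp [Stmt.headers], .condFalse l e v .elseBranch (.inr rfl) h⟩,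
      ?_, ?_, ?_⟩
    · rw [obsOf_readAnns_append]
    · exact replays_block.mpr ⟨fun _ _ => rfl, AnnSym.readsFrom_of_act_ne (by simp) _,
        (AnnSym.write_of_act_ne (by simp) _).symm⟩
    · simpa [map_sym_readAnns] using AbstractStep.ite_else i l e s₁ s₂
  | seq i v v' s₁ s₁' s₂ α h ih =>
    obtain ⟨A, hA, ho, hr, hs⟩ := ih
    exact ⟨A, hA.mono (List.subset_append_left _ _), ho, hr, .seq _ _ _ _ _ hs⟩
  | skip i v l s => exact ⟨[], .inl rfl, rfl, rfl, .skip i l s⟩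
  | input i v l x t k =>
    refine ⟨_, .inr ⟨_, List.mem_singleton_self _, .input l x t k⟩, rfl, ?_, .input i l x t⟩
    refine ⟨AnnSym.readsFrom_of_act_ne (by simp) _, AnnSym.readsFrom_of_act_ne (by simp) _, ?_⟩
    rw [Replays, AnnSym.write_of_mem_ne (by simp) v, AnnSym.write_var rfl rfl]
  | output i v l t e =>
    refine ⟨_, .inr ⟨_, List.mem_singleton_self _, .output l t e v⟩, ?_, ?_, ?_⟩
    · rw [obsOf_readAnns_append]
    · exact replays_block.mpr ⟨fun _ _ => rfl, AnnSym.readsFrom_of_act_ne (by simp) _,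
        (AnnSym.write_of_mem_ne (by simp) _).symm⟩
    · simpa [map_sym_readAnns] using AbstractStep.output i l t e

theorem ThreadStep.headers_subset {D O : Type} {R : ThreadSem D O n}
    (hR : ∀ i d s α d' s', R i d s α d' s' → s'.headers ⊆ s.headers)
    {i : Fin n} {σ σ' : Store D n} {s s' : Stmt} {α : List O} {b : Bool}
    (h : ThreadStep R i σ s α b σ' s') : s'.headers ⊆ s.headers := by
  induction h with
  | sequential s s' α d' h => exact hR _ _ _ _ _ _ h
  | seq σ' s₁ s₁' s₂ α b h ih =>
    intro x hx
    simp only [Stmt.headers, List.mem_append] at hx ⊢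
    exact hx.imp_left fun hx => ih hx
  | _ => simp [Stmt.headers]

theorem Step.headers_subset {D O : Type} {R : ThreadSem D O n}
    (hR : ∀ i d s α d' s', R i d s α d' s' → s'.headers ⊆ s.headers) {μ : Mode}
    {p q : State D n} {α : List O} (h : Step R μ p α q) (j : Fin n) :
    (q.prog j).headers ⊆ (p.prog j).headers := by
  cases h with
  | run _ _ _ _ _ _ h => exact headers_update_subset (h.headers_subset hR) j
  | switch _ _ _ _ _ _ _ h => exact headers_update_subset (h.headers_subset hR) j
  | _ => exact List.Subset.refl _

theorem ThreadStep.annotate {i : Fin n} {σ σ' : Store (Var → ℤ) n} {s s' : Stmt}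
    {α : List (Obs n)} {b : Bool} (h : ThreadStep ConcreteStep i σ s α b σ' s') :
    ∃ A, OptBlock i s.headers A ∧ obsOf A = α ∧ Replays σ.data A σ'.data ∧
      ThreadStep AbstractStep i σ.forget s (A.map AnnSym.sym) b σ'.forget s' := by
  induction h with
  | sequential s s' α d' h =>
    obtain ⟨A, hA, ho, hr, hs⟩ := h.annotate
    exact ⟨A, hA, ho, hr, .sequential _ _ _ _ _ hs⟩
  | lockYield l m h => exact ⟨[], .inl rfl, rfl, rfl, .lockYield _ l m h⟩
  | lock l m h => exact ⟨[], .inl rfl, rfl, rfl, .lock _ l m h⟩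
  | unlock l m h => exact ⟨[], .inl rfl, rfl, rfl, .unlock _ l m h⟩
  | awaitYield l c h => exact ⟨[], .inl rfl, rfl, rfl, .awaitYield _ l c h⟩
  | await l c h => exact ⟨[], .inl rfl, rfl, rfl, .await _ l c h⟩
  | signal l c => exact ⟨[], .inl rfl, rfl, rfl, .signal _ l c⟩
  | reset l c => exact ⟨[], .inl rfl, rfl, rfl, .reset _ l c⟩
  | yield l => exact ⟨[], .inl rfl, rfl, rfl, .yield _ l⟩
  | seq σ' s₁ s₁' s₂ α b h ih =>
    obtain ⟨A, hA, ho, hr, hs⟩ := ih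
    exact ⟨A, hA.mono (List.subset_append_left _ _), ho, hr, .seq _ _ _ _ _ _ _ hs⟩

theorem Step.annotate {μ : Mode} {p q : State (Var → ℤ) n} {α : List (Obs n)}
    (h : Step ConcreteStep μ p α q) :
    ∃ A, (A = [] ∨ ∃ i, OptBlock i (p.prog i).headers A) ∧ obsOf A = α ∧
      Replays p.store.data A q.store.data ∧
      Step AbstractStep μ p.forget (A.map AnnSym.sym) q.forget := by
  cases h with
  | scheduleStart σ P j => exact ⟨[], .inl rfl, rfl, rfl, .scheduleStart _ P j⟩
  | run σ σ' P i s' α h =>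
    obtain ⟨A, hA, ho, hr, hs⟩ := h.annotate
    exact ⟨A, .inr ⟨i, hA⟩, ho, hr, .run _ _ P i s' _ hs⟩
  | switch σ σ' P i j s' α h =>
    obtain ⟨A, hA, ho, hr, hs⟩ := h.annotate
    exact ⟨A, .inr ⟨i, hA⟩, ho, hr, .switch _ _ P i j s' _ hs⟩
  | descheduleSkip σ P i j h => exact ⟨[], .inl rfl, rfl, rfl, .descheduleSkip _ P i j h⟩
  | deschedulePreempt σ P c j h => exact ⟨[], .inl rfl, rfl, rfl, .deschedulePreempt _ P c j h⟩

/-- Every concrete execution has an annotated word whose abstract symbols are emitted by an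
abstract execution. -/
theorem Run.annotate {μ : Mode} {p q : State (Var → ℤ) n} {w : List (Obs n)}
    {H : Fin n → List Header} (h : Run ConcreteStep μ p w q)
    (hH : ∀ i, (p.prog i).headers ⊆ H i) :
    ∃ W, obsOf W = w ∧ Replays p.store.data W q.store.data ∧ (∀ a ∈ W, a.WellFormed) ∧
      (∀ i, BlockSeq i (H i) (threadPart i W)) ∧
      Run AbstractStep μ p.forget (W.map AnnSym.sym) q.forget := by
  induction h with
  | refl p => exact ⟨[], rfl, rfl, by simp, fun i => .nil, .refl _⟩
  | head p q r α w hs _ ih =>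
    obtain ⟨W, ho, hr, hwf, hb, hrun⟩ := ih fun i => List.Subset.trans
      (hs.headers_subset (fun _ _ _ _ _ _ h => h.headers_subset) i) (hH i)
    obtain ⟨A, hA, hoA, hrA, hsA⟩ := hs.annotate
    refine ⟨A ++ W, by rw [obsOf_append, ho, hoA], replays_append.mpr ⟨_, hrA, hr⟩, ?_, ?_,
      by rw [List.map_append]; exact .head _ _ _ _ _ hsA hrun⟩
    · rcases hA with rfl | ⟨i, rfl | ⟨hd, hh, hA⟩⟩
      · simpa using hwf
      · simpa using hwf
      · intro a ha
        rcases List.mem_append.mp ha with ha | ha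
        · exact (hA.of_mem ha).2.2
        · exact hwf a ha
    · intro j
      -- A step extends the word of its own thread by at most one whole block and leaves the other
      -- threads' words alone.
      rcases hA with rfl | ⟨i, rfl | ⟨hd, hh, hA⟩⟩
      · exact hb j
      · exact hb j
      · rw [threadPart_append]
        have htid : ∀ a ∈ A, a.sym.tid = i := fun a ha => (hA.of_mem ha).1
        by_cases hj : j = i
        · subst hj
          rw [threadPart_eq_self htid]
          exact .cons hd _ _ (hH _ hh) hA (hb _)
        · rw [threadPart_eq_nil htid hj]
          exact hb j

end Annotate

/-! ## From abstract to concrete executions -/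

section Concretize

variable {n : ℕ}

/-- Add data to a store. -/
def Store.withData {D : Type} (v : D) (σ : Store Unit n) : Store D n := ⟨v, σ.lock, σ.cond⟩

/-- Add data to a state. -/
def State.withData {D : Type} (v : D) (p : State Unit n) : State D n :=
  ⟨p.store.withData v, p.ctid, p.prog⟩

/-- The steps in `K`, given by their initial and final data and the symbols that they emit,
include all that replay a block for the abstract word `α`, with a header in `H`. -/
def Realizes (i : Fin n) (H : List Header) (α : List (AbsSym n))
    (K : (Var → ℤ) → List (Obs n) → (Var → ℤ) → Prop) : Prop :=
  (α = [] ∧ ∀ v, K v [] v) ∨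
    ∃ h ∈ H, α.length = h.size ∧ (∀ a ∈ α, a.tid = i ∧ a.loc = h.loc) ∧
      ∀ A v v', Block i h A → A.map AnnSym.sym = α → Replays v A v' → K v (obsOf A) v'

theorem Realizes.mono {i : Fin n} {H H' : List Header} {α : List (AbsSym n)}
    {K K' : (Var → ℤ) → List (Obs n) → (Var → ℤ) → Prop} (h : Realizes i H α K)
    (hH : H ⊆ H') (hK : ∀ v o v', K v o v' → K' v o v') : Realizes i H' α K' := by
  rcases h with ⟨h, hk⟩ | ⟨hd, hh, hl, hm, hk⟩
  · exact .inl ⟨h, fun v => hK _ _ _ (hk v)⟩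
  · exact .inr ⟨hd, hH hh, hl, hm, fun A v v' hA hα hr => hK _ _ _ (hk A v v' hA hα hr)⟩

theorem AbstractStep.headers_subset {i : Fin n} {d d' : Unit} {s s' : Stmt}
    {α : List (AbsSym n)} (h : AbstractStep i d s α d' s') : s'.headers ⊆ s.headers := by
  induction h <;> intro x hx <;>
    simp only [Stmt.headers, List.mem_cons, List.mem_append, List.not_mem_nil] at hx ⊢ <;> grind

theorem Expr.isTrue_congr {v w : Var → ℤ} (e : Expr) (h : ∀ x ∈ e.reads, v x = w x) :
    e.IsTrue v ↔ e.IsTrue w := by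
  rw [IsTrue, IsTrue, e.eval_congr h]

theorem length_readSyms (i : Fin n) (e : Expr) (l : Loc) :
    (readSyms i e l).length = e.reads.length := by
  simp [readSyms]

theorem mem_readSyms {i : Fin n} {e : Expr} {l : Loc} {a : AbsSym n}
    (ha : a ∈ readSyms i e l) : a.tid = i ∧ a.loc = l := by
  simp only [readSyms, List.mem_map] at ha
  obtain ⟨x, -, rfl⟩ := ha
  exact ⟨rfl, rfl⟩

/-- The branch symbol fixes the truth value under the recorded valuation, and replaying transfers it
to the current one. Loops and conditionals share a header; the emitted symbol tells them apart. -/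
theorem realizes_cond {i : Fin n} {l : Loc} {e : Expr} {act : Act}
    {H : List Header} (hH : .cond l e ∈ H) {K : (Var → ℤ) → List (Obs n) → (Var → ℤ) → Prop}
    (hT : act = .loop ∨ act = .thenBranch → ∀ v, e.IsTrue v → K v [] v)
    (hF : act = .exit ∨ act = .elseBranch → ∀ v, ¬ e.IsTrue v → K v [] v) :
    Realizes i H (readSyms i e l ++ [⟨i, act, none, l⟩]) K := by
  refine .inr ⟨_, hH, by simp [length_readSyms, Header.size], ?_, ?_⟩
  · intro a ha
    rcases List.mem_append.mp ha with ha | ha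
    · exact mem_readSyms ha
    · rw [List.mem_singleton.mp ha]; exact ⟨rfl, rfl⟩
  · intro A v v' hA hα hr
    cases hA with
    | condTrue _ _ ρ a ha he =>
      obtain ⟨hρ, -, rfl⟩ := replays_block.mp hr
      have hact : a = act := by simpa [map_sym_readAnns] using hα
      subst hact
      rw [obsOf_readAnns_append, AnnSym.write_of_mem_ne (by simp)]
      exact hT ha v ((e.isTrue_congr hρ).mp he)
    | condFalse _ _ ρ a ha he =>
      obtain ⟨hρ, -, rfl⟩ := replays_block.mp hr
      have hact : a = act := by simpa [map_sym_readAnns] using hα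
      subst hact
      rw [obsOf_readAnns_append, AnnSym.write_of_mem_ne (by simp)]
      exact hF ha v (mt (e.isTrue_congr hρ).mpr he)

/-- The block may record any valuation that agrees with the current one on the reads;
`Expr.eval_congr` then shows that its written or output value is the one computed by the concrete
step. -/
theorem AbstractStep.realizes {i : Fin n} {d d' : Unit} {s s' : Stmt} {α : List (AbsSym n)}
    (h : AbstractStep i d s α d' s') :
    Realizes i s.headers α fun v o v' => ConcreteStep i v s o v' s' := by
  induction h with
  | assign i l x e =>
    refine .inr ⟨_, List.mem_singleton_self _, by simp [length_readSyms, Header.size], ?_, ?_⟩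
    · intro a ha
      rcases List.mem_append.mp ha with ha | ha
      · exact mem_readSyms ha
      · rw [List.mem_singleton.mp ha]; exact ⟨rfl, rfl⟩
    · intro A v v' hA hα hr
      cases hA with
      | assign _ _ _ ρ =>
        obtain ⟨hρ, -, rfl⟩ := replays_block.mp hr
        rw [obsOf_readAnns_append, AnnSym.write_var rfl rfl, e.eval_congr hρ]
        exact .assign i v l x e
  | havoc i l x =>
    refine .inr ⟨_, List.mem_singleton_self _, rfl, by simp [Header.loc], ?_⟩
    intro A v v' hA hα hr
    cases hA with
    | havoc _ _ k =>
      obtain ⟨-, rfl⟩ := hr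
      rw [AnnSym.write_var rfl rfl]
      exact .havoc i v l x k
  | while_exit i l e s =>
    exact realizes_cond (by simp [Stmt.headers]) (by simp)
      fun _ v h => .while_exit i v l e s h
  | while_loop i l e s =>
    exact realizes_cond (by simp [Stmt.headers]) (fun _ v h => .while_loop i v l e s h)
      (by simp)
  | ite_then i l e s₁ s₂ =>
    exact realizes_cond (by simp [Stmt.headers]) (fun _ v h => .ite_then i v l e s₁ s₂ h)
      (by simp)
  | ite_else i l e s₁ s₂ =>
    exact realizes_cond (by simp [Stmt.headers]) (by simp)
      fun _ v h => .ite_else i v l e s₁ s₂ h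
  | seq i s₁ s₁' s₂ α h ih =>
    exact ih.mono (List.subset_append_left _ _) fun v o v' h => .seq _ _ _ _ _ _ _ h
  | skip i l s => exact .inl ⟨rfl, fun v => .skip i v l s⟩
  | input i l x t =>
    refine .inr ⟨_, List.mem_singleton_self _, rfl, by simp [Header.loc], ?_⟩
    intro A v v' hA hα hr
    cases hA with
    | input _ _ _ k =>
      obtain ⟨-, -, rfl⟩ := hr
      rw [AnnSym.write_of_mem_ne (by simp) v, AnnSym.write_var rfl rfl]
      exact .input i v l x t k
  | output i l t e =>
    refine .inr ⟨_, List.mem_singleton_self _, by simp [length_readSyms, Header.size], ?_, ?_⟩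
    · intro a ha
      rcases List.mem_append.mp ha with ha | ha
      · exact mem_readSyms ha
      · rw [List.mem_singleton.mp ha]; exact ⟨rfl, rfl⟩
    · intro A v v' hA hα hr
      cases hA with
      | output _ _ _ ρ =>
        obtain ⟨hρ, -, rfl⟩ := replays_block.mp hr
        rw [obsOf_readAnns_append, AnnSym.write_of_mem_ne (by simp), e.eval_congr hρ]
        exact .output i v l t e

theorem ThreadStep.realizes {i : Fin n} {σ σ' : Store Unit n} {s s' : Stmt}
    {α : List (AbsSym n)} {b : Bool} (h : ThreadStep AbstractStep i σ s α b σ' s') :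
    Realizes i s.headers α fun v o v' =>
      ThreadStep ConcreteStep i (σ.withData v) s o b (σ'.withData v') s' := by
  induction h with
  | sequential s s' α d' h =>
    exact h.realizes.mono (List.Subset.refl _)
      fun v o v' h => .sequential (σ.withData v) s s' o v' h
  | lockYield l m h => exact .inl ⟨rfl, fun v => .lockYield _ l m h⟩
  | lock l m h => exact .inl ⟨rfl, fun v => .lock (σ.withData v) l m h⟩
  | unlock l m h => exact .inl ⟨rfl, fun v => .unlock (σ.withData v) l m h⟩
  | awaitYield l c h => exact .inl ⟨rfl, fun v => .awaitYield _ l c h⟩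
  | await l c h => exact .inl ⟨rfl, fun v => .await _ l c h⟩
  | signal l c => exact .inl ⟨rfl, fun v => .signal (σ.withData v) l c⟩
  | reset l c => exact .inl ⟨rfl, fun v => .reset (σ.withData v) l c⟩
  | yield l => exact .inl ⟨rfl, fun v => .yield _ l⟩
  | seq σ' s₁ s₁' s₂ α b h ih =>
    exact ih.mono (List.subset_append_left _ _) fun v o v' h => .seq _ _ _ _ _ _ _ h

theorem Step.realizes {μ : Mode} {p q : State Unit n} {α : List (AbsSym n)}
    (h : Step AbstractStep μ p α q) :
    (α = [] ∧ ∀ v, Step ConcreteStep μ (p.withData v) [] (q.withData v)) ∨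
      ∃ i, Realizes i (p.prog i).headers α fun v o v' =>
        Step ConcreteStep μ (p.withData v) o (q.withData v') := by
  cases h with
  | scheduleStart σ P j => exact .inl ⟨rfl, fun v => .scheduleStart _ P j⟩
  | run σ σ' P i s' α h =>
    exact .inr ⟨i, h.realizes.mono (List.Subset.refl _)
      fun v o v' h => .run _ _ P i s' o h⟩
  | switch σ σ' P i j s' α h =>
    exact .inr ⟨i, h.realizes.mono (List.Subset.refl _)
      fun v o v' h => .switch _ _ P i j s' o h⟩
  | descheduleSkip σ P i j h => exact .inl ⟨rfl, fun v => .descheduleSkip _ P i j h⟩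
  | deschedulePreempt σ P c j h => exact .inl ⟨rfl, fun v => .deschedulePreempt _ P c j h⟩

/-- An abstract execution over the abstract symbols of a suitable annotated word yields a
concrete execution with its concrete observation sequence. -/
theorem Run.concretize {μ : Mode} {p q : State Unit n} {u : List (AbsSym n)}
    {H : Fin n → List Header} (hinj : ∀ i, ∀ h ∈ H i, ∀ h' ∈ H i, h.loc = h'.loc → h = h')
    (hrun : Run AbstractStep μ p u q) :
    ∀ (W : List (AnnSym n)) (v v' : Var → ℤ), W.map AnnSym.sym = u → Replays v W v' →
      (∀ i, BlockSeq i (H i) (threadPart i W)) → (∀ i, (p.prog i).headers ⊆ H i) →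
      Run ConcreteStep μ (p.withData v) (obsOf W) (q.withData v') := by
  induction hrun with
  | refl p =>
    intro W v v' hW hr _ _
    obtain rfl := List.map_eq_nil_iff.mp hW
    obtain rfl : v' = v := hr
    exact .refl _
  | head p q r α w hs _ ih =>
    intro W v v' hW hr hb hH
    have hH' : ∀ i, (q.prog i).headers ⊆ H i := fun i => List.Subset.trans
      (hs.headers_subset (fun _ _ _ _ _ _ h => h.headers_subset) i) (hH i)
    -- Silent steps consume no annotated symbols; they are either scheduling steps or steps of a
    -- thread that emit nothing.
    have hempty : α = [] → Step ConcreteStep μ (p.withData v) [] (q.withData v) →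
        Run ConcreteStep μ (p.withData v) (obsOf W) (r.withData v') := by
      rintro rfl hk
      exact .head _ _ _ [] _ hk (ih W v v' hW hr hb hH')
    rcases hs.realizes with ⟨hα, hk⟩ | ⟨i, ⟨hα, hk⟩ | ⟨hd, hh, hlen, hmem, hk⟩⟩
    · exact hempty hα (hk v)
    · exact hempty hα (hk v)
    · obtain ⟨A, W, rfl, rfl, rfl⟩ := List.map_eq_append_iff.mp hW
      obtain ⟨v₁, hrA, hrW⟩ := replays_append.mp hr
      have hsym : ∀ a ∈ A, a.sym.tid = i ∧ a.sym.loc = hd.loc := fun a ha =>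
        hmem _ (List.mem_map_of_mem ha)
      have htid : ∀ a ∈ A, a.sym.tid = i := fun a ha => (hsym a ha).1
      have hbi := hb i
      rw [threadPart_append, threadPart_eq_self htid] at hbi
      -- The step's symbols are contiguous in the word and all belong to thread `i`, so they open
      -- that thread's block sequence and must be its first block.
      obtain ⟨hA, hbW⟩ := hbi.of_append (hinj i) (hH i hh) (by simpa using hlen)
        fun a ha => (hsym a ha).2
      rw [obsOf_append]
      refine .head _ _ _ _ _ (hk A v v₁ hA rfl hrA) (ih W v₁ v' rfl hrW (fun j => ?_) hH')
      by_cases hj : j = i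
      · subst hj; exact hbW
      · simpa [threadPart_append, threadPart_eq_nil htid hj] using hb j

end Concretize

/-- A program whose data statements stem from `C` and that passes the check against `C` is
preemption-safe with respect to `C`. -/
theorem Check.preemptionSafe {n : ℕ} {v₀ : Var → ℤ} {c₀ : CondVar → Bool} {C C' : Program n}
    (hC : C.UniqueLocs) (hsub : ∀ i, (C' i).headers ⊆ (C i).headers)
    (hcheck : Check c₀ C' C none) : PreemptionSafe v₀ c₀ C' C := by
  rintro w ⟨p, hrun, hp⟩
  obtain ⟨W, rfl, hr, hwf, hb, habs⟩ := hrun.annotate (H := fun i => (C i).headers) hsub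
  obtain ⟨u, ⟨q, hq, hfin⟩, hsw⟩ := hcheck.exists_swaps ⟨p.forget, habs, hp⟩
  obtain ⟨U, rfl, hrU, hth, -, heq⟩ := hsw.exists_annotated rfl hwf
  -- The execution of `C` ends with the same data as that of `C'`, since commutations preserve the
  -- replayed valuation.
  exact ⟨obsOf U, ⟨q.withData p.store.data, hq.concretize
    (fun i h hh h' hh' he => hC.header_eq hh hh' he) U _ _ rfl (hrU _ _ hr)
    (fun i => hth i ▸ hb i) (fun i => List.Subset.refl _), hfin⟩, heq⟩

end ConcW

theorem proposition3 {n : ℕ} (v₀ : ConcW.Var → ℤ) (c₀ : ConcW.CondVar → Bool)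
    (C C' : ConcW.Program n) (hC : C.UniqueLocs) (hsyn : ConcW.Synthesizes c₀ C C') :
    ConcW.PreemptionSafe v₀ c₀ C' C :=
  hsyn.2.preemptionSafe hC hsyn.1.headers_subset
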